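/- Let $\mu$ be the Borel measure on $\mathbb R^2$ with density $x=(x_1,x_2)\mapsto |x|^2=x_1^2+x_2^2$ with respect to Lebesgue measure. For a Borel set $A\subset\mathbb R^2$ with $\mu(A)<\infty$ put $$\mu^+(\partial A):=\liminf_{\varepsilon\to0^+}\frac{\mu(A+\varepsilon B)-\mu(A)}{\varepsilon},$$ where $B$ is the closed Euclidean unit ball centred at the origin. A convex body is a compact convex set with non-empty interior, and a set $L$ is symmetric about a point $p$ if $L-p=-(L-p)$. Then for every convex body $K\subset\mathbb R^2$ and every compact convex set $L\subset\mathbb R^2$ that contains the origin and is symmetric about some point, $$\mu^+(\partial(K+L))\ \ge\ \mu^+(\partial K).$$ Moreover, $\mu$ is a Radon measure that is not a constant multiple of Lebesgue measure; hence this property does not characterize the multiples of Lebesgue measure among the Radon measures on $\mathbb R^2$. -/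

import Mathlib

open scoped ENNReal Topology Pointwise

/-- A convex body: a compact convex set with non-empty interior. -/
structure IsConvexBody {E : Type*} [TopologicalSpace E] [AddCommGroup E] [Module ℝ E]
    (K : Set E) : Prop where
  isCompact : IsCompact K
  convex : Convex ℝ K
  interior_nonempty : (interior K).Nonempty

/-- A set `A` is symmetric if `A = -A`. -/
def IsSymmetric {E : Type*} [AddCommGroup E] (A : Set E) : Prop :=
  A = -A

/-- A set `A` is symmetric about the point `p` if the translate `A - p` is symmetric. -/
def IsSymmetricAbout {E : Type*} [AddCommGroup E] (A : Set E) (p : E) : Prop :=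
  IsSymmetric (A - {p})

/-- The outer Minkowski content `μ⁺(∂A) = liminf_{ε → 0⁺} (μ (A + ε B) - μ A) / ε` of the set `A`
with respect to the measure `μ`, where `B` is the closed unit ball, as an element of `[0, ∞]`.
For `μ A < ∞` the subtraction is a genuine one, since `A ⊆ A + ε B`. -/
noncomputable def minkowskiContent {E : Type*} [NormedAddCommGroup E] [NormedSpace ℝ E]
    [MeasurableSpace E] (μ : MeasureTheory.Measure E) (A : Set E) : ℝ≥0∞ :=
  Filter.liminf
    (fun ε : ℝ => (μ (A + ε • Metric.closedBall (0 : E) 1) - μ A) / ENNReal.ofReal ε)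
    (𝓝[>] (0 : ℝ))

/-- The measure on the Euclidean plane with density `x₁² + x₂²` with respect to the Lebesgue
measure. -/
noncomputable def normSqMeasure : MeasureTheory.Measure (EuclideanSpace ℝ (Fin 2)) :=
  MeasureTheory.volume.withDensity (fun x => ENNReal.ofReal (x 0 ^ 2 + x 1 ^ 2))

open MeasureTheory Set Filter Metric

/-! The shell inequality μ(K+εB) - μ(K) ≤ μ(K+L+εB) - μ(K+L) holds for every single ε ≥ 0, and the
liminf inherits it. Transposed, it says that the gain μ(C+L) - μ(C) does not decrease when C = K is
replaced by C = K+εB. In this form it passes from two sets L to their sum, and in the plane a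
centrally symmetric convex set is a limit of sums of segments (`exists_segmentSums_approx`).
Rotation invariance of μ then leaves one vertical segment of length t.

If C has upper boundary g over [a, b] and G = g + t/2, the gain is t ∫ (G² + x² + t²/12). By
continuity it is enough that its lower right derivative along C + δB is nonnegative
(`eventually_measureReal_add_vertSeg_growth`, integrated in `normSqMeasure_shell_add_segment`). The
part of the graph with G ≥ 0 only helps. On k = min(G, 0), with slope m, the upward growth changes ∫
k² at rate at least 2 ∫ k √(1+m²) ≤ 0, while the lengthening of the base at both ends contributes
k(a)² + k(b)² + a² + b².

That the second term compensates the first is `neg_two_mul_integral_mul_sqrt_le`, the heart of the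
matter. Concavity orders the tangent directions of the graph; an elementary inequality between two
ordered directions is integrated over all pairs of points, and completing a square finishes. -/

/-! ### Weighted length of a concave graph -/

lemma sqrt_one_add_sq_sub_le {p q : ℝ} (h : q ≤ p) :
    √(1 + p ^ 2) - √(1 + q ^ 2) ≤ p - q := by
  have h1 : √(1 + p ^ 2) ≤ √(1 + q ^ 2) + (p - q) := by
    rw [Real.sqrt_le_left (by positivity)]
    have h2 := Real.sq_sqrt (show (0:ℝ) ≤ 1 + q ^ 2 by positivity)
    have h3 : q ≤ √(1 + q ^ 2) := Real.le_sqrt_of_sq_le (by linarith)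
    nlinarith [mul_nonneg (sub_nonneg.2 h) (sub_nonneg.2 h3)]
  linarith

lemma neg_lt_sqrt_one_add_sq (q : ℝ) : 0 < √(1 + q ^ 2) + q := by
  have : |q| < √(1 + q ^ 2) := by
    rw [← Real.sqrt_sq_eq_abs]
    exact Real.sqrt_lt_sqrt (sq_nonneg q) (by linarith)
  linarith [neg_abs_le q]

/-- For unit vectors of angles `θ ≤ φ` in `[0, π]` with cotangents `p ≥ q` this says
`1 - cos (φ - θ) ≤ cos θ - cos φ`. -/
lemma sqrt_mul_sqrt_sub_le {p q : ℝ} (h : q ≤ p) :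
    √(1 + p ^ 2) * √(1 + q ^ 2) - 1 - p * q ≤ p * √(1 + q ^ 2) - q * √(1 + p ^ 2) := by
  have h1 := sqrt_one_add_sq_sub_le h
  have h2 := neg_lt_sqrt_one_add_sq q
  have h3 := Real.sq_sqrt (show (0:ℝ) ≤ 1 + q ^ 2 by positivity)
  -- The right side minus the left side is exactly (√(1+q²) + q) · ((p - q) - (√(1+p²) - √(1+q²))).
  nlinarith [mul_nonneg h2.le (sub_nonneg.2 h1)]

/-- The left side is symmetric in y and z, and the sign makes the right side insensitive to their
order, so the estimate can be integrated over the whole square. -/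
lemma sqrt_mul_sqrt_sub_le_ite {m : ℝ → ℝ} (hm : Antitone m) (y z : ℝ) :
    √(1 + m y ^ 2) * √(1 + m z ^ 2) - 1 - m y * m z ≤
      (if y ≤ z then (1 : ℝ) else -1) * (m y * √(1 + m z ^ 2))
        - (if y ≤ z then (1 : ℝ) else -1) * (m z * √(1 + m y ^ 2)) := by
  split_ifs with h
  · have := sqrt_mul_sqrt_sub_le (hm h)
    linarith
  · have := sqrt_mul_sqrt_sub_le (hm (not_le.1 h).le)
    linarith

lemma integrable_prod_of_bounded {ρ : Measure ℝ} [IsFiniteMeasure ρ] {F : ℝ × ℝ → ℝ} {C : ℝ}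
    (hF : Measurable F) (hC : ∀ p, |F p| ≤ C) : Integrable F (ρ.prod ρ) :=
  Integrable.of_bound hF.aestronglyMeasurable C (Filter.Eventually.of_forall hC)

/-- When m is the slope of k, this is 2 k(z) - k(a) - k(b): the sign kernel turns slopes back into
values of k. -/
lemma integral_ite_le_mul {m : ℝ → ℝ} {a b z : ℝ} (hz : z ∈ Ioc a b)
    (hm : IntegrableOn m (Ioc a b)) :
    ∫ y in Ioc a b, (if y ≤ z then (1 : ℝ) else -1) * m y
      = (∫ y in a..z, m y) - ∫ y in z..b, m y := by
  have hu : Ioc a b = Ioc a z ∪ Ioc z b := (Ioc_union_Ioc_eq_Ioc hz.1.le hz.2).symm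
  have h1 : ∫ y in Ioc a z, (if y ≤ z then (1 : ℝ) else -1) * m y = ∫ y in Ioc a z, m y :=
    setIntegral_congr_fun measurableSet_Ioc fun y hy => by simp [hy.2]
  have h2 : ∫ y in Ioc z b, (if y ≤ z then (1 : ℝ) else -1) * m y = ∫ y in Ioc z b, -m y :=
    setIntegral_congr_fun measurableSet_Ioc fun y hy => by simp [not_le.2 hy.1]
  have hi1 : IntegrableOn m (Ioc a z) := hm.mono_set (Ioc_subset_Ioc_right hz.2)
  have hi2 : IntegrableOn m (Ioc z b) := hm.mono_set (Ioc_subset_Ioc_left hz.1.le)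
  have hd : Disjoint (Ioc a z) (Ioc z b) := Ioc_disjoint_Ioc_of_le le_rfl
  rw [hu, setIntegral_union hd measurableSet_Ioc, h1, h2, integral_neg,
    intervalIntegral.integral_of_le hz.1.le, intervalIntegral.integral_of_le hz.2, sub_eq_add_neg]
  · exact hi1.congr_fun (fun y hy => by simp [hy.2]) measurableSet_Ioc
  · exact hi2.neg.congr_fun (fun y hy => by simp [not_le.2 hy.1]) measurableSet_Ioc

/-- The weighted length of a concave graph is controlled by its end points. -/
lemma neg_two_mul_integral_mul_sqrt_le {k m : ℝ → ℝ} {a b C : ℝ} (hab : a ≤ b)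
    (hm : Antitone m) (hC : ∀ x, |m x| ≤ C)
    (hk : ∀ x ∈ Icc a b, ∀ y ∈ Icc a b, x ≤ y → ∫ s in x..y, m s = k y - k x) :
    -(2 * ∫ x in a..b, k x * √(1 + m x ^ 2)) ≤ k a ^ 2 + k b ^ 2 + a ^ 2 + b ^ 2 := by
  set w : ℝ → ℝ := fun x => √(1 + m x ^ 2) with hw
  have hmm : Measurable m := hm.measurable
  have hwm : Measurable w := (measurable_const.add (hmm.pow_const 2)).sqrt
  have hC0 : 0 ≤ C := (abs_nonneg _).trans (hC 0)
  have hwC : ∀ x, |w x| ≤ 1 + C := fun x => by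
    rw [abs_of_nonneg (Real.sqrt_nonneg _), Real.sqrt_le_left (by positivity)]
    have := sq_le_sq' (neg_le_of_abs_le (hC x)) (le_of_abs_le (hC x))
    nlinarith
  set ρ : Measure ℝ := volume.restrict (Ioc a b) with hρ
  have hmi : Integrable m ρ := Integrable.of_bound hmm.aestronglyMeasurable C (.of_forall hC)
  have hwi : Integrable w ρ := Integrable.of_bound hwm.aestronglyMeasurable _ (.of_forall hwC)
  set σ : ℝ × ℝ → ℝ := fun p => if p.1 ≤ p.2 then (1 : ℝ) else -1 with hσ
  have hσm : Measurable σ :=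
    Measurable.ite (measurableSet_le measurable_fst measurable_snd) measurable_const
      measurable_const
  have hσ1 : ∀ p, |σ p| ≤ 1 := fun p => by simp only [hσ]; split_ifs <;> simp
  have hF1 : Integrable (fun p : ℝ × ℝ => w p.1 * w p.2 - 1 - m p.1 * m p.2) (ρ.prod ρ) := by
    refine (((hwi.mul_prod hwi).sub (integrable_const 1)).sub (hmi.mul_prod hmi))
  have hT : Integrable (fun p : ℝ × ℝ => σ p * (m p.1 * w p.2)) (ρ.prod ρ) := by
    refine integrable_prod_of_bounded (C := 1 * (C * (1 + C)))
      (hσm.mul ((hmm.comp measurable_fst).mul (hwm.comp measurable_snd))) fun p => ?_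
    rw [abs_mul, abs_mul]
    exact mul_le_mul (hσ1 p) (mul_le_mul (hC _) (hwC _) (abs_nonneg _) hC0) (by positivity)
      zero_le_one
  have hT' : Integrable (fun p : ℝ × ℝ => σ p * (m p.2 * w p.1)) (ρ.prod ρ) := by
    refine integrable_prod_of_bounded (C := 1 * (C * (1 + C)))
      (hσm.mul ((hmm.comp measurable_snd).mul (hwm.comp measurable_fst))) fun p => ?_
    rw [abs_mul, abs_mul]
    exact mul_le_mul (hσ1 p) (mul_le_mul (hC _) (hwC _) (abs_nonneg _) hC0) (by positivity)
      zero_le_one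
  have hmono := integral_mono hF1 (hT.sub hT') (fun p => sqrt_mul_sqrt_sub_le_ite hm p.1 p.2)
  have hΛ : ∫ x, w x ∂ρ = ∫ x in a..b, w x := (intervalIntegral.integral_of_le hab).symm
  have hM : ∫ x, m x ∂ρ = k b - k a := by
    rw [← hk a ⟨le_rfl, hab⟩ b ⟨hab, le_rfl⟩ hab, intervalIntegral.integral_of_le hab]
  have hL : ∫ p, (w p.1 * w p.2 - 1 - m p.1 * m p.2) ∂(ρ.prod ρ)
      = (∫ x, w x ∂ρ) ^ 2 - (b - a) ^ 2 - (k b - k a) ^ 2 := by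
    have hW : Integrable (fun p : ℝ × ℝ => w p.1 * w p.2 - 1) (ρ.prod ρ) :=
      (hwi.mul_prod hwi).sub (integrable_const 1)
    rw [integral_sub hW (hmi.mul_prod hmi),
      integral_sub (hwi.mul_prod hwi) (integrable_const 1), integral_prod_mul, integral_prod_mul,
      hM]
    have : (ρ.prod ρ).real univ = (b - a) ^ 2 := by
      rw [← univ_prod_univ, measureReal_prod_prod]
      simp [hρ, hab, sq]
    simp [this]
    ring
  -- Nothing is assumed on the measurability of k; on the interval it is k(a) plus a primitive of m,
  -- hence continuous there.
  have hkwi : Integrable (fun z => k z * w z) ρ := by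
    have : IntegrableOn (fun z => (∫ s in a..z, m s) * w z + k a * w z) (Ioc a b) := by
      refine Integrable.add ?_ (hwi.const_mul _)
      refine Integrable.of_bound (C := C * (b - a) * (1 + C)) ?_ ?_
      · refine AEStronglyMeasurable.mul ?_ hwm.aestronglyMeasurable
        exact (intervalIntegral.continuous_primitive
          (fun x y => hm.intervalIntegrable) a).aestronglyMeasurable
      · refine (ae_restrict_iff' measurableSet_Ioc).2 (.of_forall fun z hz => ?_)
        rw [norm_mul]
        refine mul_le_mul ?_ (hwC z) (norm_nonneg _)
          (mul_nonneg hC0 (sub_nonneg.2 hab))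
        refine (intervalIntegral.norm_integral_le_of_norm_le_const fun x _ => hC x).trans ?_
        rw [abs_of_nonneg (sub_nonneg.2 hz.1.le)]
        exact mul_le_mul_of_nonneg_left (by linarith [hz.2]) hC0
    refine this.congr_fun (fun z hz => ?_) measurableSet_Ioc
    simp only
    rw [hk a ⟨le_rfl, hab⟩ z ⟨hz.1.le, hz.2⟩ hz.1.le]
    ring
  have hTv : ∫ p, σ p * (m p.1 * w p.2) ∂(ρ.prod ρ)
      = 2 * (∫ z, k z * w z ∂ρ) - (k a + k b) * ∫ z, w z ∂ρ := by
    rw [integral_prod_symm _ hT, ← integral_const_mul, ← integral_const_mul,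
      ← integral_sub (hkwi.const_mul _) (hwi.const_mul _)]
    refine setIntegral_congr_fun measurableSet_Ioc fun z hz => ?_
    have h1 : ∀ y, σ (y, z) * (m (y, z).1 * w (y, z).2)
        = ((if y ≤ z then (1 : ℝ) else -1) * m y) * w z := fun y => by simp only [hσ]; ring
    simp only [h1]
    rw [integral_mul_const, integral_ite_le_mul hz hmi,
      hk a ⟨le_rfl, hab⟩ z ⟨hz.1.le, hz.2⟩ hz.1.le, hk z ⟨hz.1.le, hz.2⟩ b ⟨hab, le_rfl⟩ hz.2]
    ring
  -- The sign kernel is antisymmetric off the diagonal, which is a null set.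
  have hTv' : ∫ p, σ p * (m p.2 * w p.1) ∂(ρ.prod ρ)
      = - ∫ p, σ p * (m p.1 * w p.2) ∂(ρ.prod ρ) := by
    rw [← integral_prod_swap, ← integral_neg]
    refine integral_congr_ae ?_
    have hd : ∀ᵐ p ∂(ρ.prod ρ), p.1 ≠ p.2 := by
      have hs : MeasurableSet {p : ℝ × ℝ | p.1 = p.2} :=
        measurableSet_eq_fun measurable_fst measurable_snd
      rw [ae_iff]
      simp only [ne_eq, not_not]
      rw [Measure.measure_prod_null hs]
      refine .of_forall fun x => ?_
      have : (Prod.mk x ⁻¹' {p : ℝ × ℝ | p.1 = p.2}) = {x} := by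
        ext y; simp [eq_comm]
      change ρ (Prod.mk x ⁻¹' {p : ℝ × ℝ | p.1 = p.2}) = 0
      rw [this]; simp
    filter_upwards [hd] with p hp
    simp only [hσ, Prod.swap]
    rcases lt_or_gt_of_ne hp with h | h
    · simp [h.le, not_le.2 h]
    · simp [h.le, not_le.2 h]
  have hR := integral_sub hT hT'
  simp only [Pi.sub_apply] at hmono
  have hkw : ∫ x in a..b, k x * w x = ∫ z, k z * w z ∂ρ := intervalIntegral.integral_of_le hab
  rw [hkw]
  have e1 := hmono
  rw [hR, hTv', hTv] at e1
  have e2 := hL.symm.le.trans e1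
  -- With Λ = ∫ w the integrated inequality reads -4∫kw ≤ (b-a)² + (k(b)-k(a))² - Λ² -
  -- 2(k(a)+k(b))Λ. Completing the square in Λ leaves (b-a)² + 2k(a)² + 2k(b)², and (b-a)² ≤ 2a² +
  -- 2b².
  nlinarith [sq_nonneg ((∫ x, w x ∂ρ) + (k a + k b)), sq_nonneg (a + b)]

/-- A concave function on a closed interval has a field of supergradients on the interior for which
the bound `neg_two_mul_integral_mul_sqrt_le` holds on all compact subintervals. -/
lemma exists_supergradient {k : ℝ → ℝ} {a b : ℝ} (hk : ConcaveOn ℝ (Icc a b) k) :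
    ∃ m : ℝ → ℝ, (∀ x ∈ Ioo a b, ∀ y ∈ Icc a b, k y ≤ k x + m x * (y - x)) ∧
      AntitoneOn m (Ioo a b) ∧ ∀ α β, a < α → α ≤ β → β < b →
        -(2 * ∫ x in α..β, k x * √(1 + m x ^ 2)) ≤ k α ^ 2 + k β ^ 2 + α ^ 2 + β ^ 2 := by
  have hc : ConvexOn ℝ (Icc a b) (-k) := hk.neg
  set d : ℝ → ℝ := fun x => derivWithin (-k) (Ioi x) x with hd
  have hint : interior (Icc a b) = Ioo a b := interior_Icc
  have hder : ∀ x ∈ Ioo a b, HasDerivWithinAt (-k) (d x) (Ioi x) x := fun x hx =>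
    hc.hasDerivWithinAt_rightDeriv_of_mem_interior (by rwa [hint])
  have hmono : MonotoneOn d (Ioo a b) := by
    have := hc.monotoneOn_rightDeriv
    rwa [hint] at this
  have hanti : AntitoneOn (fun x => -d x) (Ioo a b) := fun x hx y hy h => neg_le_neg (hmono hx hy h)
  refine ⟨fun x => -d x, fun x hx y hy => ?_, hanti, fun α β hα hαβ hβ => ?_⟩
  · rcases lt_trichotomy x y with h | h | h
    · have h1 := hc.rightDeriv_le_slope_of_mem_interior (by rwa [hint]) hy h
      rw [slope_def_field, le_div_iff₀ (sub_pos.2 h)] at h1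
      simp only [Pi.neg_apply] at h1
      simp only [hd]
      nlinarith
    · subst h; simp
    · have h1 := hc.slope_le_leftDeriv_of_mem_interior hy (by rwa [hint]) h
      have h2 := hc.leftDeriv_le_rightDeriv_of_mem_interior (by rwa [hint] : x ∈ interior (Icc a b))
      have h3 := h1.trans h2
      rw [slope_def_field, div_le_iff₀ (sub_pos.2 h)] at h3
      simp only [Pi.neg_apply] at h3
      simp only [hd]
      nlinarith
  · have hsub : Icc α β ⊆ Ioo a b := fun x hx => ⟨hα.trans_le hx.1, hx.2.trans_lt hβ⟩
    -- Slopes may blow up at the ends of the interval. Precomposing with the projection onto [α, β]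
    -- gives a globally antitone bounded function that agrees with the slope on [α, β].
    set c : ℝ → ℝ := fun x => (projIcc α β hαβ x : ℝ) with hcdef
    have hcI : ∀ x, c x ∈ Icc α β := fun x => (projIcc α β hαβ x).2
    have hcid : ∀ x ∈ Icc α β, c x = x := fun x hx => by simp [hcdef, projIcc_of_mem hαβ hx]
    have hcm : Monotone c := fun x y h => monotone_projIcc hαβ h
    have hcont : ContinuousOn (-k) (Icc α β) :=
      (hc.continuousOn_interior.mono (by rwa [hint]))
    have hA : Antitone (fun x => -d (c x)) := fun x y h =>
      hanti (hsub (hcI x)) (hsub (hcI y)) (hcm h)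
    have key := neg_two_mul_integral_mul_sqrt_le (k := k) (m := fun x => -d (c x))
      (C := max |d α| |d β|) hαβ hA
      (fun x => by
        rw [abs_neg]
        exact abs_le_max_abs_abs (hmono (hsub ⟨le_rfl, hαβ⟩) (hsub (hcI x)) (hcI x).1)
          (hmono (hsub (hcI x)) (hsub ⟨hαβ, le_rfl⟩) (hcI x).2))
      (fun x hx y hy hxy => by
        have hxyI : Icc x y ⊆ Icc α β := Icc_subset_Icc hx.1 hy.2
        rw [intervalIntegral.integral_eq_sub_of_hasDeriv_right_of_le (f := k) hxy]
        · simpa using (hcont.mono hxyI).neg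
        · intro z hz
          have hz' := hxyI ⟨hz.1.le, hz.2.le⟩
          simp only [hcid z hz']
          simpa using (hder z (hsub hz')).neg
        · exact hA.intervalIntegrable)
    refine le_trans (le_of_eq ?_) key
    congr 2
    refine intervalIntegral.integral_congr fun x hx => ?_
    rw [uIcc_of_le hαβ] at hx
    simp only [hcid x hx]

/-! ### Measure gained by adding a vertical segment -/

/-- The measure with density `x² + y²` on `ℝ × ℝ`. -/
noncomputable def prodNormSqMeasure : Measure (ℝ × ℝ) :=
  volume.withDensity (fun p => ENNReal.ofReal (p.1 ^ 2 + p.2 ^ 2))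

instance : IsLocallyFiniteMeasure prodNormSqMeasure :=
  IsLocallyFiniteMeasure.withDensity_ofReal (by fun_prop)

/-- The upper boundary function of a planar set. -/
noncomputable def topFun (C : Set (ℝ × ℝ)) (x : ℝ) : ℝ := sSup {y | (x, y) ∈ C}

/-- The vertical segment from the origin to `(0, t)`. -/
def vertSeg (t : ℝ) : Set (ℝ × ℝ) := {0} ×ˢ Icc 0 t

lemma isCompact_vertSeg (t : ℝ) : IsCompact (vertSeg t) := isCompact_singleton.prod isCompact_Icc

section TopFun

variable {C : Set (ℝ × ℝ)} {a b : ℝ}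

lemma isCompact_verticalSection (hC : IsCompact C) (x : ℝ) : IsCompact {y | (x, y) ∈ C} := by
  have h : {y | (x, y) ∈ C} = Prod.snd '' (C ∩ Prod.fst ⁻¹' {x}) := by
    ext y
    simp only [mem_ofPred_eq, mem_image, mem_inter_iff, mem_preimage, mem_singleton_iff, Prod.exists]
    constructor
    · exact fun h => ⟨x, y, ⟨h, rfl⟩, rfl⟩
    · rintro ⟨_, _, ⟨h, rfl⟩, rfl⟩
      exact h
  rw [h]
  exact (hC.inter_right (isClosed_singleton.preimage continuous_fst)).image continuous_snd

lemma le_topFun (hC : IsCompact C) {x y : ℝ} (h : (x, y) ∈ C) : y ≤ topFun C x :=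
  le_csSup (isCompact_verticalSection hC x).bddAbove h

lemma topFun_mem (hC : IsCompact C) {x y : ℝ} (h : (x, y) ∈ C) : (x, topFun C x) ∈ C :=
  (isCompact_verticalSection hC x).sSup_mem ⟨y, h⟩

lemma topFun_mem_of_image (hC : IsCompact C) (hI : Prod.fst '' C = Icc a b) {x : ℝ}
    (hx : x ∈ Icc a b) : (x, topFun C x) ∈ C := by
  rw [← hI] at hx
  obtain ⟨⟨x', y⟩, h, rfl⟩ := hx
  exact topFun_mem hC h

lemma mem_Icc_of_mem (hI : Prod.fst '' C = Icc a b) {x y : ℝ} (h : (x, y) ∈ C) : x ∈ Icc a b := by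
  rw [← hI]
  exact ⟨_, h, rfl⟩

lemma concaveOn_topFun (hC : IsCompact C) (hconv : Convex ℝ C) (hI : Prod.fst '' C = Icc a b) :
    ConcaveOn ℝ (Icc a b) (topFun C) := by
  refine ⟨convex_Icc a b, fun x hx y hy s t hs ht hst => ?_⟩
  refine le_topFun hC ?_
  have := hconv (topFun_mem_of_image hC hI hx) (topFun_mem_of_image hC hI hy) hs ht hst
  simpa using this

lemma upperSemicontinuousOn_topFun (hC : IsCompact C) (hI : Prod.fst '' C = Icc a b) :
    UpperSemicontinuousOn (topFun C) (Icc a b) := by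
  intro x hx r hr
  have hK : IsClosed (Prod.fst '' (C ∩ Prod.snd ⁻¹' Ici r)) :=
    ((hC.inter_right (isClosed_Ici.preimage continuous_snd)).image continuous_fst).isClosed
  have hxn : x ∉ Prod.fst '' (C ∩ Prod.snd ⁻¹' Ici r) := by
    rintro ⟨⟨x', y⟩, ⟨h1, h2⟩, rfl⟩
    exact absurd (hr.trans_le h2) (not_lt.2 (le_topFun hC h1))
  filter_upwards [mem_nhdsWithin_of_mem_nhds (hK.isOpen_compl.mem_nhds hxn), self_mem_nhdsWithin]
    with z hz hzI
  by_contra h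
  exact hz ⟨_, ⟨topFun_mem_of_image hC hI hzI, not_lt.1 h⟩, rfl⟩

lemma ConcaveOn.lowerSemicontinuousWithinAt_endpoint {f : ℝ → ℝ} {e o : ℝ} (heo : e ≠ o)
    (hf : ConcaveOn ℝ (uIcc e o) f) : LowerSemicontinuousWithinAt f (uIcc e o) e := by
  intro r hr
  set l : ℝ → ℝ := fun y => (1 - (y - e) / (o - e)) * f e + (y - e) / (o - e) * f o with hl
  have hlc : Continuous l := by fun_prop
  have hle : l e = f e := by simp [hl]
  have hev : ∀ᶠ y in 𝓝[uIcc e o] e, r < l y :=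
    mem_nhdsWithin_of_mem_nhds (hlc.continuousAt.eventually_const_lt (by rwa [hle]))
  filter_upwards [hev, self_mem_nhdsWithin] with y hy hyI
  refine hy.trans_le ?_
  have hne : o - e ≠ 0 := sub_ne_zero.2 heo.symm
  have hs : 0 ≤ (y - e) / (o - e) ∧ (y - e) / (o - e) ≤ 1 := by
    rcases lt_or_gt_of_ne heo with h | h
    · rw [uIcc_of_le h.le] at hyI
      exact ⟨div_nonneg (by linarith [hyI.1]) (by linarith),
        (div_le_one (by linarith)).2 (by linarith [hyI.2])⟩
    · rw [uIcc_of_ge h.le] at hyI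
      exact ⟨div_nonneg_of_nonpos (by linarith [hyI.2]) (by linarith),
        (div_le_one_of_neg (by linarith)).2 (by linarith [hyI.1])⟩
  have := hf.2 left_mem_uIcc right_mem_uIcc (sub_nonneg.2 hs.2) hs.1 (by ring)
  have e1 : (1 - (y - e) / (o - e)) • e + ((y - e) / (o - e)) • o = y := by
    simp only [smul_eq_mul]; field_simp; ring
  rw [e1] at this
  exact this

/-- Concavity gives continuity in the interior only. At an end point it gives lower semicontinuity,
since the graph lies above a chord; a downward jump there is excluded by compactness of C. -/
lemma continuousOn_topFun (hC : IsCompact C) (hconv : Convex ℝ C) (hI : Prod.fst '' C = Icc a b)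
    (hab : a < b) : ContinuousOn (topFun C) (Icc a b) := by
  have hconc := concaveOn_topFun hC hconv hI
  intro x hx
  rcases eq_or_lt_of_le hx.1 with h | h
  · subst h
    refine continuousWithinAt_iff_lower_upperSemicontinuousWithinAt.2
      ⟨?_, upperSemicontinuousOn_topFun hC hI a hx⟩
    rw [← uIcc_of_le hab.le] at hconc ⊢
    exact hconc.lowerSemicontinuousWithinAt_endpoint hab.ne
  rcases eq_or_lt_of_le hx.2 with h' | h'
  · subst h'
    refine continuousWithinAt_iff_lower_upperSemicontinuousWithinAt.2
      ⟨?_, upperSemicontinuousOn_topFun hC hI x hx⟩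
    rw [← uIcc_of_ge hab.le] at hconc ⊢
    exact hconc.lowerSemicontinuousWithinAt_endpoint hab.ne'
  · have hd := hconc.neg.continuousOn_interior.neg
    rw [interior_Icc] at hd
    have := (hd.continuousAt (Ioo_mem_nhds h h')).continuousWithinAt (s := Icc a b)
    simpa using this

lemma mem_add_vertSeg {t x y : ℝ} :
    (x, y) ∈ C + vertSeg t ↔ ∃ s ∈ Icc 0 t, (x, y - s) ∈ C := by
  constructor
  · rintro ⟨⟨x1, y1⟩, h1, ⟨x2, y2⟩, ⟨h2, h3⟩, h⟩
    simp only [mem_singleton_iff, Prod.mk_add_mk, Prod.mk.injEq] at h2 h3 h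
    refine ⟨y2, h3, ?_⟩
    rw [← h.1, ← h.2, h2]
    simpa using h1
  · rintro ⟨s, hs, h⟩
    exact ⟨_, h, (0, s), ⟨rfl, hs⟩, by simp⟩

/-- Each vertical slice of C is a segment, so the gain sits on top of it and depends on the upper
boundary alone. -/
lemma mem_add_vertSeg_diff (hC : IsCompact C) (hconv : Convex ℝ C) (hI : Prod.fst '' C = Icc a b)
    {t x y : ℝ} :
    (x, y) ∈ (C + vertSeg t) \ C ↔ x ∈ Icc a b ∧ y ∈ Ioc (topFun C x) (topFun C x + t) := by
  rw [Set.mem_sdiff, mem_add_vertSeg]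
  constructor
  · rintro ⟨⟨s, hs, h⟩, hn⟩
    have hx := mem_Icc_of_mem hI h
    refine ⟨hx, ?_, by linarith [le_topFun hC h, hs.2]⟩
    by_contra hy
    refine hn ?_
    have := hconv.segment_subset h (topFun_mem hC h)
    apply this
    rw [← Prod.image_mk_segment_right, segment_eq_Icc (le_topFun hC h)]
    exact ⟨y, ⟨by linarith [hs.1], not_lt.1 hy⟩, rfl⟩
  · rintro ⟨hx, hy⟩
    refine ⟨⟨y - topFun C x, ⟨by linarith [hy.1], by linarith [hy.2]⟩, ?_⟩, fun h => ?_⟩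
    · rw [sub_sub_cancel]
      exact topFun_mem_of_image hC hI hx
    · exact absurd hy.1 (not_lt.2 (le_topFun hC h))

/-- Expanding about the midpoint g + t/2 leaves the variance t²/12 as a constant; hence the shift by
t/2 in what follows. -/
lemma lintegral_Ioc_sq_add_sq (x g : ℝ) {t : ℝ} (ht : 0 ≤ t) :
    ∫⁻ y in Ioc g (g + t), ENNReal.ofReal (x ^ 2 + y ^ 2)
      = ENNReal.ofReal (t * ((g + t / 2) ^ 2 + x ^ 2 + t ^ 2 / 12)) := by
  have hi : IntegrableOn (fun y : ℝ => x ^ 2 + y ^ 2) (Ioc g (g + t)) :=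
    ((by fun_prop : Continuous fun y : ℝ => x ^ 2 + y ^ 2).integrableOn_Icc).mono_set
      Ioc_subset_Icc_self
  rw [← ofReal_integral_eq_lintegral_ofReal hi (.of_forall fun y => by positivity)]
  congr 1
  rw [← intervalIntegral.integral_of_le (by linarith), intervalIntegral.integral_add
    (by simp) (by simp), integral_pow]
  simp
  ring

/-- The growth of the measure when the vertical segment is added to a convex set. -/
lemma measureReal_add_vertSeg (hC : IsCompact C) (hconv : Convex ℝ C)
    (hI : Prod.fst '' C = Icc a b) (hab : a < b) {t : ℝ} (ht : 0 ≤ t) :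
    prodNormSqMeasure.real (C + vertSeg t) - prodNormSqMeasure.real C
      = ∫ x in a..b, t * ((topFun C x + t / 2) ^ 2 + x ^ 2 + t ^ 2 / 12) := by
  have hCt : IsCompact (C + vertSeg t) := hC.add (isCompact_vertSeg t)
  have hsub : C ⊆ C + vertSeg t := fun p hp => ⟨p, hp, 0, ⟨rfl, by simpa using ht⟩, by simp⟩
  rw [← measureReal_sdiff hsub hC.measurableSet hCt.measure_lt_top.ne]
  have hS : MeasurableSet ((C + vertSeg t) \ C) := hCt.measurableSet.diff hC.measurableSet
  have hcont : ContinuousOn (fun x => t * ((topFun C x + t / 2) ^ 2 + x ^ 2 + t ^ 2 / 12))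
      (Icc a b) := by
    have := continuousOn_topFun hC hconv hI hab
    fun_prop
  rw [measureReal_def, prodNormSqMeasure, withDensity_apply _ hS, ← lintegral_indicator hS,
    Measure.volume_eq_prod, lintegral_prod _ ((by fun_prop : Measurable fun p : ℝ × ℝ =>
      ENNReal.ofReal (p.1 ^ 2 + p.2 ^ 2)).indicator hS).aemeasurable]
  have hin : ∀ x, ∫⁻ y, ((C + vertSeg t) \ C).indicator
      (fun p : ℝ × ℝ => ENNReal.ofReal (p.1 ^ 2 + p.2 ^ 2)) (x, y)
      = (Icc a b).indicator (fun x => ENNReal.ofReal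
        (t * ((topFun C x + t / 2) ^ 2 + x ^ 2 + t ^ 2 / 12))) x := by
    intro x
    by_cases hx : x ∈ Icc a b
    · rw [indicator_of_mem hx, ← lintegral_Ioc_sq_add_sq x _ ht,
        ← lintegral_indicator measurableSet_Ioc]
      refine lintegral_congr fun y => ?_
      by_cases hy : y ∈ Ioc (topFun C x) (topFun C x + t)
      · rw [indicator_of_mem hy, indicator_of_mem ((mem_add_vertSeg_diff hC hconv hI).2 ⟨hx, hy⟩)]
      · rw [indicator_of_notMem hy, indicator_of_notMem
          fun h => hy ((mem_add_vertSeg_diff hC hconv hI).1 h).2]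
    · rw [indicator_of_notMem hx, lintegral_eq_zero_of_ae_eq_zero (.of_forall fun y => ?_)]
      exact indicator_of_notMem (fun h => hx ((mem_add_vertSeg_diff hC hconv hI).1 h).1) _
  simp only [hin]
  rw [lintegral_indicator measurableSet_Icc, ← ofReal_integral_eq_lintegral_ofReal
    (hcont.integrableOn_Icc) (.of_forall fun x => by positivity), ENNReal.toReal_ofReal
    (integral_nonneg fun x => by positivity), integral_Icc_eq_integral_Ioc,
    intervalIntegral.integral_of_le hab.le]

end TopFun

/-! ### First-order growth of the gain along parallel bodies -/

lemma AntitoneOn.intervalIntegrable_sqrt_one_add_sq {m : ℝ → ℝ} {α β : ℝ}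
    (hm : AntitoneOn m (uIcc α β)) :
    IntervalIntegrable (fun x => √(1 + m x ^ 2)) volume α β := by
  have hi := hm.intervalIntegrable (μ := volume)
  have h1 : IntervalIntegrable (fun x => 1 + |m x|) volume α β :=
    intervalIntegrable_const.add hi.abs
  refine h1.mono_fun ?_ (.of_forall fun x => ?_)
  · exact (by fun_prop : Continuous fun y : ℝ => √(1 + y ^ 2)).comp_aestronglyMeasurable
      hi.aestronglyMeasurable_restrict_uIoc
  · simp only
    rw [Real.norm_of_nonneg (Real.sqrt_nonneg _), Real.norm_of_nonneg (by positivity),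
      Real.sqrt_le_left (by positivity)]
    nlinarith [abs_nonneg (m x), sq_abs (m x)]

/-- A rise by at most 2ω from v ∈ [-R, 0] costs at most 4Rω in the square; if the rise could cross
0, then v² itself is below that amount. -/
lemma sq_sub_le_sq_of_le {u v R ω : ℝ} (hu : u ≤ 0) (hvR : -R ≤ v) (hv : v ≤ 0) (hω : 0 ≤ ω)
    (h : u ≤ v + 2 * ω) : v ^ 2 - 4 * R * ω ≤ u ^ 2 := by
  have h1 : -v * ω ≤ R * ω := mul_le_mul_of_nonneg_right (by linarith) hω
  rcases le_total (v + 2 * ω) 0 with h2 | h2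
  · nlinarith
  · have h3 : v * v ≤ -v * (2 * ω) := by nlinarith
    nlinarith [sq_nonneg u]

/-- One step of the growth estimate: `k'` plays the role of the upper boundary of the
`δ`-neighbourhood of the hypograph of the concave function `k ≤ 0`. -/
lemma integral_sq_le_of_le_supergradient {k k' m : ℝ → ℝ} {a b δ R ω : ℝ}
    (hδ : 0 < δ) (hδab : 2 * δ ≤ b - a) (hω : 0 ≤ ω)
    (hkc : ContinuousOn k (Icc a b)) (hk0 : ∀ x, k x ≤ 0) (hkR : ∀ x ∈ Icc a b, -R ≤ k x)
    (hk'c : ContinuousOn k' (Icc (a - δ) (b + δ))) (hk'0 : ∀ x, k' x ≤ 0)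
    (hm : AntitoneOn m (Ioo a b))
    (hmk : ∀ α β, a < α → α ≤ β → β < b →
        -(2 * ∫ x in α..β, k x * √(1 + m x ^ 2)) ≤ k α ^ 2 + k β ^ 2 + α ^ 2 + β ^ 2)
    (hgrow : ∀ x ∈ Ioo a b, k' x ≤ k x + δ * √(1 + m x ^ 2))
    (hka : ∀ x ∈ Icc a (a + δ), k a - ω ≤ k x) (hkb : ∀ x ∈ Icc (b - δ) b, k b - ω ≤ k x)
    (hk'a : ∀ x ∈ Icc (a - δ) (a + δ), k' x ≤ k a + 2 * ω)
    (hk'b : ∀ x ∈ Icc (b - δ) (b + δ), k' x ≤ k b + 2 * ω) :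
    (∫ x in a..b, (k x ^ 2 + x ^ 2)) - 24 * R * ω * δ
      ≤ ∫ x in (a - δ)..(b + δ), (k' x ^ 2 + x ^ 2) := by
  have hmI : ∀ {α β}, a < α → α ≤ β → β < b → AntitoneOn m (uIcc α β) := fun h1 h2 h3 => by
    rw [uIcc_of_le h2]
    exact hm.mono fun x hx => ⟨h1.trans_le hx.1, hx.2.trans_lt h3⟩
  have hint' : ∀ {α β}, a - δ ≤ α → α ≤ β → β ≤ b + δ →
      IntervalIntegrable (fun x => k' x ^ 2) volume α β := fun h1 h2 h3 => by
    refine ContinuousOn.intervalIntegrable ?_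
    rw [uIcc_of_le h2]
    exact (hk'c.mono (Icc_subset_Icc h1 h3)).pow 2
  have hint : ∀ {α β}, a ≤ α → α ≤ β → β ≤ b →
      IntervalIntegrable (fun x => k x ^ 2) volume α β := fun h1 h2 h3 => by
    refine ContinuousOn.intervalIntegrable ?_
    rw [uIcc_of_le h2]
    exact (hkc.mono (Icc_subset_Icc h1 h3)).pow 2
  have hsq : ∀ α β, IntervalIntegrable (fun x : ℝ => x ^ 2) volume α β := fun α β => by simp
  rw [intervalIntegral.integral_add (hint le_rfl (by linarith) le_rfl) (hsq _ _),
    intervalIntegral.integral_add (hint' le_rfl (by linarith) le_rfl) (hsq _ _)]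
  have s1 := intervalIntegral.integral_add_adjacent_intervals
    (hint (α := a) (β := a + δ) le_rfl (by linarith) (by linarith))
    (hint (α := a + δ) (β := b) (by linarith) (by linarith) (by linarith))
  have s2 := intervalIntegral.integral_add_adjacent_intervals
    (hint (α := a + δ) (β := b - δ) (by linarith) (by linarith) (by linarith))
    (hint (α := b - δ) (β := b) (by linarith) (by linarith) (by linarith))
  have s1' := intervalIntegral.integral_add_adjacent_intervals
    (hint' (α := a - δ) (β := a + δ) le_rfl (by linarith) (by linarith))
    (hint' (α := a + δ) (β := b + δ) (by linarith) (by linarith) (by linarith))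
  have s2' := intervalIntegral.integral_add_adjacent_intervals
    (hint' (α := a + δ) (β := b - δ) (by linarith) (by linarith) (by linarith))
    (hint' (α := b - δ) (β := b + δ) (by linarith) (by linarith) (by linarith))
  have haI : a ∈ Icc a b := ⟨le_rfl, by linarith⟩
  have hbI : b ∈ Icc a b := ⟨by linarith, le_rfl⟩
  have hksq : ∀ {x y}, x ∈ Icc a b → y ∈ Icc a b → k y - ω ≤ k x →
      k x ^ 2 ≤ k y ^ 2 + 2 * R * ω := fun {x y} hx hy h => by
    have h1 := hkR x hx
    have h2 := hkR y hy
    have h3 := hk0 x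
    have h4 := hk0 y
    rcases le_total (k x) (k y) with h5 | h5
    · nlinarith [mul_le_mul (by linarith : k y - k x ≤ ω) (by linarith : -k x - k y ≤ 2 * R)
        (by linarith) hω]
    · nlinarith [mul_nonneg (by linarith : (0:ℝ) ≤ R) hω]
  -- the four end pieces
  have e1 : ∫ x in a..(a + δ), k x ^ 2 ≤ δ * (k a ^ 2 + 2 * R * ω) := by
    have := intervalIntegral.integral_mono_on (μ := volume) (a := a) (b := a + δ)
      (by linarith) (hint le_rfl (by linarith) (by linarith))
      (intervalIntegrable_const (c := k a ^ 2 + 2 * R * ω))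
      (fun x hx => hksq ⟨hx.1, by linarith [hx.2]⟩ haI (hka x hx))
    rw [intervalIntegral.integral_const] at this
    simpa using this
  have e2 : ∫ x in (b - δ)..b, k x ^ 2 ≤ δ * (k b ^ 2 + 2 * R * ω) := by
    have := intervalIntegral.integral_mono_on (μ := volume) (a := b - δ) (b := b)
      (by linarith) (hint (by linarith) (by linarith) le_rfl)
      (intervalIntegrable_const (c := k b ^ 2 + 2 * R * ω))
      (fun x hx => hksq ⟨by linarith [hx.1], hx.2⟩ hbI (hkb x hx))
    rw [intervalIntegral.integral_const] at this
    simpa using this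
  -- The enlarged interval reaches δ beyond the end point, so this piece has length 2δ against δ in
  -- `e1`. The surplus δ k(a)² pays for part of the loss in the middle.
  have e3 : 2 * δ * (k a ^ 2 - 4 * R * ω) ≤ ∫ x in (a - δ)..(a + δ), k' x ^ 2 := by
    have := intervalIntegral.integral_mono_on (μ := volume) (a := a - δ) (b := a + δ)
      (by linarith) (intervalIntegrable_const (c := k a ^ 2 - 4 * R * ω))
      (hint' le_rfl (by linarith) (by linarith))
      (fun x hx => sq_sub_le_sq_of_le (hk'0 x) (hkR a haI) (hk0 a) hω (hk'a x hx))
    rw [intervalIntegral.integral_const, smul_eq_mul] at this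
    linarith
  have e4 : 2 * δ * (k b ^ 2 - 4 * R * ω) ≤ ∫ x in (b - δ)..(b + δ), k' x ^ 2 := by
    have := intervalIntegral.integral_mono_on (μ := volume) (a := b - δ) (b := b + δ)
      (by linarith) (intervalIntegrable_const (c := k b ^ 2 - 4 * R * ω))
      (hint' (by linarith) (by linarith) le_rfl)
      (fun x hx => sq_sub_le_sq_of_le (hk'0 x) (hkR b hbI) (hk0 b) hω (hk'b x hx))
    rw [intervalIntegral.integral_const, smul_eq_mul] at this
    linarith
  -- the middle piece
  have hkw : IntervalIntegrable (fun x => k x * √(1 + m x ^ 2)) volume (a + δ) (b - δ) := by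
    refine (hmI (by linarith) (by linarith)
      (by linarith)).intervalIntegrable_sqrt_one_add_sq.continuousOn_mul ?_
    rw [uIcc_of_le (by linarith)]
    exact hkc.mono (Icc_subset_Icc (by linarith) (by linarith))
  have e5 : (∫ x in (a + δ)..(b - δ), k x ^ 2)
      + 2 * δ * (∫ x in (a + δ)..(b - δ), k x * √(1 + m x ^ 2))
      ≤ ∫ x in (a + δ)..(b - δ), k' x ^ 2 := by
    rw [← intervalIntegral.integral_const_mul, ← intervalIntegral.integral_add
      (hint (by linarith) (by linarith) (by linarith)) (hkw.const_mul _)]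
    refine intervalIntegral.integral_mono_on (by linarith)
      ((hint (by linarith) (by linarith) (by linarith)).add (hkw.const_mul _))
      (hint' (by linarith) (by linarith) (by linarith)) fun x hx => ?_
    -- As k ≤ 0, multiplying the growth bound by k reverses it; then k'² ≥ 2kk' - k².
    have h1 := hgrow x ⟨by linarith [hx.1], by linarith [hx.2]⟩
    have h2 := mul_le_mul_of_nonpos_left h1 (hk0 x)
    nlinarith [sq_nonneg (k' x - k x)]
  have e6 := hmk (a + δ) (b - δ) (by linarith) (by linarith) (by linarith)
  have e7 := hksq ⟨by linarith, by linarith⟩ haI (hka (a + δ) ⟨by linarith, le_rfl⟩)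
  have e8 := hksq ⟨by linarith, by linarith⟩ hbI (hkb (b - δ) ⟨le_rfl, by linarith⟩)
  have e9 : (∫ x in a..b, x ^ 2) + δ * (a ^ 2 + b ^ 2) ≤ ∫ x in (a - δ)..(b + δ), x ^ 2 := by
    simp only [integral_pow]
    have := mul_nonneg (sq_nonneg δ) (by linarith : 0 ≤ b - a)
    have := pow_pos hδ 3
    push_cast
    nlinarith
  have e10 : (a + δ) ^ 2 + (b - δ) ^ 2 ≤ a ^ 2 + b ^ 2 := by nlinarith
  -- Error count in units of Rωδ: 8 + 2 at each of the two ends, and 4 from moving the end values to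
  -- a + δ and b - δ, giving 24.
  have e11 := mul_le_mul_of_nonneg_left (show -(k a ^ 2 + k b ^ 2 + 4 * R * ω + a ^ 2 + b ^ 2)
    ≤ 2 * ∫ x in (a + δ)..(b - δ), k x * √(1 + m x ^ 2) by linarith) hδ.le
  nlinarith

/-- The closed Euclidean disc of radius `δ` in `ℝ × ℝ`. -/
def prodDisc (δ : ℝ) : Set (ℝ × ℝ) := {p | p.1 ^ 2 + p.2 ^ 2 ≤ δ ^ 2}

section Disc

variable {C : Set (ℝ × ℝ)} {a b δ : ℝ}

lemma abs_fst_le_of_mem_prodDisc (hδ : 0 ≤ δ) {p : ℝ × ℝ} (hp : p ∈ prodDisc δ) : |p.1| ≤ δ :=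
  abs_le_of_sq_le_sq (by have : p.1 ^ 2 + p.2 ^ 2 ≤ δ ^ 2 := hp; nlinarith [sq_nonneg p.2]) hδ

lemma abs_snd_le_of_mem_prodDisc (hδ : 0 ≤ δ) {p : ℝ × ℝ} (hp : p ∈ prodDisc δ) : |p.2| ≤ δ :=
  abs_le_of_sq_le_sq (by have : p.1 ^ 2 + p.2 ^ 2 ≤ δ ^ 2 := hp; nlinarith [sq_nonneg p.1]) hδ

lemma isCompact_prodDisc (hδ : 0 ≤ δ) : IsCompact (prodDisc δ) := by
  refine Metric.isCompact_of_isClosed_isBounded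
    (isClosed_le (by fun_prop) continuous_const) ?_
  refine (Metric.isBounded_closedBall (x := (0 : ℝ × ℝ)) (r := δ)).subset fun p hp => ?_
  rw [mem_closedBall_zero_iff, Prod.norm_def]
  exact max_le (abs_fst_le_of_mem_prodDisc hδ hp) (abs_snd_le_of_mem_prodDisc hδ hp)

lemma convex_prodDisc : Convex ℝ (prodDisc δ) := by
  have h : ConvexOn ℝ univ fun p : ℝ × ℝ => p.1 ^ 2 + p.2 ^ 2 :=
    ((even_two.convexOn_pow (𝕜 := ℝ)).comp_linearMap (LinearMap.fst ℝ ℝ ℝ)).add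
      ((even_two.convexOn_pow (𝕜 := ℝ)).comp_linearMap (LinearMap.snd ℝ ℝ ℝ))
  simpa [prodDisc] using h.convex_le (δ ^ 2)

lemma zero_mem_prodDisc : (0 : ℝ × ℝ) ∈ prodDisc δ := by
  simp [prodDisc, sq_nonneg]

lemma subset_add_prodDisc : C ⊆ C + prodDisc δ :=
  fun p hp => ⟨p, hp, 0, zero_mem_prodDisc, by simp⟩

lemma image_fst_add_prodDisc (hI : Prod.fst '' C = Icc a b) (hab : a ≤ b) (hδ : 0 ≤ δ) :
    Prod.fst '' (C + prodDisc δ) = Icc (a - δ) (b + δ) := by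
  have h1 : Prod.fst '' prodDisc δ = Icc (-δ) δ := by
    ext x
    constructor
    · rintro ⟨p, hp, rfl⟩
      exact abs_le.1 (abs_fst_le_of_mem_prodDisc hδ hp)
    · intro hx
      exact ⟨(x, 0), by simpa [prodDisc] using sq_le_sq' hx.1 hx.2, rfl⟩
  have h2 : Prod.fst '' (C + prodDisc δ) = Prod.fst '' C + Prod.fst '' prodDisc δ :=
    image_add (LinearMap.fst ℝ ℝ ℝ)
  rw [h2, h1, hI, Icc_add_Icc hab (by linarith), sub_eq_add_neg]

lemma exists_topFun_add_prodDisc_eq (hC : IsCompact C) (hI : Prod.fst '' C = Icc a b) (hab : a ≤ b)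
    (hδ : 0 ≤ δ) {x : ℝ} (hx : x ∈ Icc (a - δ) (b + δ)) :
    ∃ x' ∈ Icc a b, ∃ d ∈ prodDisc δ, x = x' + d.1 ∧
      topFun (C + prodDisc δ) x ≤ topFun C x' + d.2 := by
  obtain ⟨⟨x', y'⟩, h', d, hd, h⟩ := topFun_mem_of_image (hC.add (isCompact_prodDisc hδ))
    (image_fst_add_prodDisc hI hab hδ) hx
  have e1 := congrArg Prod.fst h
  have e2 := congrArg Prod.snd h
  simp only [Prod.fst_add, Prod.snd_add] at e1 e2
  exact ⟨x', mem_Icc_of_mem hI h', d, hd, e1.symm, by linarith [le_topFun hC h']⟩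

/-- Cauchy–Schwarz against (-m, 1): a graph of slope m rises vertically by at most δ√(1+m²) when
thickened by δ. -/
lemma sub_mul_le_mul_sqrt (m : ℝ) (hδ : 0 ≤ δ) {d : ℝ × ℝ} (hd : d ∈ prodDisc δ) :
    d.2 - m * d.1 ≤ δ * √(1 + m ^ 2) := by
  have hd' : d.1 ^ 2 + d.2 ^ 2 ≤ δ ^ 2 := hd
  refine abs_le_of_sq_le_sq' ?_ (by positivity) |>.2
  rw [mul_pow, Real.sq_sqrt (by positivity)]
  nlinarith [sq_nonneg (d.1 + m * d.2), sq_nonneg m]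

lemma neg_mul_le_mul_sqrt (m : ℝ) (hδ : 0 ≤ δ) {d : ℝ × ℝ} (hd : d ∈ prodDisc δ) :
    -(m * d.1) ≤ δ * √(1 + m ^ 2) := by
  have h := sub_mul_le_mul_sqrt (d := (d.1, 0)) m hδ
    (by have hd' : d.1 ^ 2 + d.2 ^ 2 ≤ δ ^ 2 := hd
        simp only [prodDisc, mem_ofPred_eq]; nlinarith [sq_nonneg d.2])
  simpa using h

/-- Right lower Dini derivative at `0` of the growth of the measure under adding a vertical segment
along the parallel bodies of a convex set. -/
lemma eventually_measureReal_add_vertSeg_growth (hC : IsCompact C) (hconv : Convex ℝ C)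
    (hI : Prod.fst '' C = Icc a b) (hab : a < b) {t : ℝ} (ht : 0 ≤ t) {η : ℝ} (hη : 0 < η) :
    ∀ᶠ δ in 𝓝[>] (0 : ℝ),
      (prodNormSqMeasure.real (C + vertSeg t) - prodNormSqMeasure.real C) - η * δ
      ≤ prodNormSqMeasure.real (C + prodDisc δ + vertSeg t)
        - prodNormSqMeasure.real (C + prodDisc δ) := by
  set G : ℝ → ℝ := fun x => topFun C x + t / 2 with hG
  -- G² = min(G, 0)² + max(G, 0)². The second term only grows with the set, and truncation at 0
  -- preserves concavity, so the integral estimate is needed for k alone.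
  set k : ℝ → ℝ := fun x => min (G x) 0 with hk
  have hGc : ContinuousOn G (Icc a b) :=
    (continuousOn_topFun hC hconv hI hab).add continuousOn_const
  have hkc : ContinuousOn k (Icc a b) := hGc.inf continuousOn_const
  have hGconc : ConcaveOn ℝ (Icc a b) G :=
    (concaveOn_topFun hC hconv hI).add (concaveOn_const _ (convex_Icc a b))
  have hkconc : ConcaveOn ℝ (Icc a b) k := hGconc.inf (concaveOn_const _ (convex_Icc a b))
  have hk0 : ∀ x, k x ≤ 0 := fun x => min_le_right _ _
  obtain ⟨m, hm1, hm2, hm3⟩ := exists_supergradient hkconc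
  obtain ⟨R, hR⟩ : ∃ R, ∀ x ∈ Icc a b, -R ≤ k x := by
    obtain ⟨r, hr⟩ := (isCompact_Icc.image_of_continuousOn hkc).bddBelow
    exact ⟨-r, fun x hx => by rw [neg_neg]; exact hr ⟨x, hx, rfl⟩⟩
  have haI : a ∈ Icc a b := ⟨le_rfl, hab.le⟩
  have hbI : b ∈ Icc a b := ⟨hab.le, le_rfl⟩
  have hR0 : 0 ≤ R := by linarith [hR a haI, hk0 a]
  -- The constant 24R is the error of `integral_sq_le_of_le_supergradient`.
  obtain ⟨ω, hω, hωη⟩ : ∃ ω > 0, t * (24 * R * ω) ≤ η := by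
    refine ⟨η / (t * (24 * R) + 1), by positivity, ?_⟩
    rw [show t * (24 * R * (η / (t * (24 * R) + 1))) = η * (t * (24 * R) / (t * (24 * R) + 1)) by
      ring]
    refine mul_le_of_le_one_right hη.le ((div_le_one (by positivity)).2 (by linarith))
  obtain ⟨δ₁, hδ₁, hcont⟩ : ∃ δ₁ > 0, ∀ e ∈ ({a, b} : Set ℝ), ∀ x ∈ Icc a b, |x - e| ≤ δ₁ →
      |k x - k e| < ω := by
    obtain ⟨r1, hr1, h1⟩ := Metric.continuousWithinAt_iff.1 (hkc a haI) ω hω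
    obtain ⟨r2, hr2, h2⟩ := Metric.continuousWithinAt_iff.1 (hkc b hbI) ω hω
    refine ⟨min r1 r2 / 2, by positivity, fun e he x hx hxe => ?_⟩
    have h3 : min r1 r2 / 2 < min r1 r2 := half_lt_self (by positivity)
    rcases he with rfl | rfl
    · exact h1 hx (by rw [Real.dist_eq]; exact hxe.trans_lt (h3.trans_le (min_le_left _ _)))
    · exact h2 hx (by rw [Real.dist_eq]; exact hxe.trans_lt (h3.trans_le (min_le_right _ _)))
  have hδ₂ : 0 < min (min (δ₁ / 2) ω) ((b - a) / 2) := by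
    have := sub_pos.2 hab
    positivity
  filter_upwards [Ioo_mem_nhdsGT hδ₂] with δ hδ
  obtain ⟨hδ, hδ'⟩ := hδ
  have hd1 : 2 * δ ≤ δ₁ := by
    linarith [hδ'.trans_le ((min_le_left _ _).trans (min_le_left _ _))]
  have hd2 : δ ≤ ω := (hδ'.trans_le ((min_le_left _ _).trans (min_le_right _ _))).le
  have hd3 : 2 * δ ≤ b - a := by linarith [hδ'.trans_le (min_le_right _ _)]
  have hC' : IsCompact (C + prodDisc δ) := hC.add (isCompact_prodDisc hδ.le)
  have hconv' : Convex ℝ (C + prodDisc δ) := hconv.add convex_prodDisc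
  have hI' := image_fst_add_prodDisc hI hab.le hδ.le
  have hab' : a - δ < b + δ := by linarith
  set G' : ℝ → ℝ := fun x => topFun (C + prodDisc δ) x + t / 2 with hG'
  set k' : ℝ → ℝ := fun x => min (G' x) 0 with hk'
  have hG'c : ContinuousOn G' (Icc (a - δ) (b + δ)) :=
    (continuousOn_topFun hC' hconv' hI' hab').add continuousOn_const
  have hk'c : ContinuousOn k' (Icc (a - δ) (b + δ)) := hG'c.inf continuousOn_const
  have hGG' : ∀ x ∈ Icc a b, G x ≤ G' x := fun x hx =>
    add_le_add_left (le_topFun hC' (subset_add_prodDisc (topFun_mem_of_image hC hI hx))) _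
  have hgrow : ∀ x ∈ Ioo a b, k' x ≤ k x + δ * √(1 + m x ^ 2) := by
    intro x hx
    obtain ⟨x', hx', d, hd, hxd, htop⟩ := exists_topFun_add_prodDisc_eq hC hI hab.le hδ.le
      (x := x) ⟨by linarith [hx.1], by linarith [hx.2]⟩
    have h1 := hm1 x hx x' hx'
    have h2 : x' - x = -d.1 := by linarith
    rw [h2] at h1
    rcases le_total (G x') 0 with h | h
    · have h3 : k x' = G x' := min_eq_left h
      have h4 := sub_mul_le_mul_sqrt (m x) hδ.le hd
      have h5 : k' x ≤ G x' + d.2 := (min_le_left _ _).trans (by simp only [hG, hG']; linarith)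
      linarith
    -- Here truncation has already put k at its ceiling 0, so only the horizontal displacement
    -- matters.
    · have h3 : k x' = 0 := min_eq_right h
      have h4 := neg_mul_le_mul_sqrt (m x) hδ.le hd
      have h5 : k' x ≤ 0 := min_le_right _ _
      linarith
  have hend : ∀ e ∈ ({a, b} : Set ℝ), ∀ x ∈ Icc (a - δ) (b + δ), |x - e| ≤ δ →
      k' x ≤ k e + 2 * ω := by
    intro e he x hx hxe
    obtain ⟨x', hx', d, hd, hxd, htop⟩ := exists_topFun_add_prodDisc_eq hC hI hab.le hδ.le hx
    have h1 := abs_fst_le_of_mem_prodDisc hδ.le hd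
    have h2 := abs_snd_le_of_mem_prodDisc hδ.le hd
    have h3 := (abs_lt.1 (hcont e he x' hx' (by
      rw [show x' - e = (x - e) + -d.1 by linarith]
      refine (abs_add_le _ _).trans ?_
      rw [abs_neg]; linarith))).2
    have h4 : k' x ≤ k x' + δ := by
      rw [hk, ← min_add_add_right]
      refine min_le_min ?_ (by linarith)
      simp only [hG, hG']
      linarith [le_abs_self d.2]
    linarith
  have key := integral_sq_le_of_le_supergradient (R := R) (ω := ω) hδ hd3 hω.le hkc hk0 hR hk'c
    (fun x => min_le_right _ _) hm2 hm3 hgrow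
    (fun x hx => by
      have := hcont a (by simp) x ⟨hx.1, by linarith [hx.2]⟩
        (by rw [abs_of_nonneg (by linarith [hx.1])]; linarith [hx.2])
      linarith [(abs_lt.1 this).1])
    (fun x hx => by
      have := hcont b (by simp) x ⟨by linarith [hx.1], hx.2⟩
        (by rw [abs_of_nonpos (by linarith [hx.2])]; linarith [hx.1])
      linarith [(abs_lt.1 this).1])
    (fun x hx => hend a (by simp) x ⟨hx.1, by linarith [hx.2]⟩
      (abs_le.2 ⟨by linarith [hx.1], by linarith [hx.2]⟩))
    (fun x hx => hend b (by simp) x ⟨by linarith [hx.1], hx.2⟩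
      (abs_le.2 ⟨by linarith [hx.1], by linarith [hx.2]⟩))
  rw [measureReal_add_vertSeg hC hconv hI hab ht, measureReal_add_vertSeg hC' hconv' hI' hab' ht]
  have hint : ∀ {f : ℝ → ℝ} {α β : ℝ}, α ≤ β → ContinuousOn f (Icc α β) →
      IntervalIntegrable f volume α β := fun h hf =>
    ContinuousOn.intervalIntegrable (by rwa [uIcc_of_le h])
  have hsplit : ∀ (g : ℝ → ℝ) (α β : ℝ), α ≤ β → ContinuousOn g (Icc α β) →
      ∫ x in α..β, t * (g x ^ 2 + x ^ 2 + t ^ 2 / 12)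
        = t * ((∫ x in α..β, (min (g x) 0 ^ 2 + x ^ 2)) + (∫ x in α..β, max (g x) 0 ^ 2)
          + (β - α) * (t ^ 2 / 12)) := by
    intro g α β hαβ hg
    have c1 : ContinuousOn (fun x => min (g x) 0 ^ 2 + x ^ 2) (Icc α β) :=
      ((hg.inf continuousOn_const).pow 2).add (continuousOn_id.pow 2)
    have c2 : ContinuousOn (fun x => max (g x) 0 ^ 2) (Icc α β) :=
      (hg.sup continuousOn_const).pow 2
    rw [intervalIntegral.integral_const_mul, ← smul_eq_mul (β - α),
      ← intervalIntegral.integral_const, ← intervalIntegral.integral_add (hint hαβ c1) (hint hαβ c2),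
      ← intervalIntegral.integral_add ((hint hαβ c1).add (hint hαβ c2)) intervalIntegrable_const]
    congr 1
    refine intervalIntegral.integral_congr fun x _ => ?_
    rcases le_total (g x) 0 with h | h
    · simp [min_eq_left h, max_eq_right h]
    · simp [min_eq_right h, max_eq_left h]; ring
  have hp : ∫ x in a..b, max (G x) 0 ^ 2 ≤ ∫ x in (a - δ)..(b + δ), max (G' x) 0 ^ 2 := by
    have c1 : ContinuousOn (fun x => max (G x) 0 ^ 2) (Icc a b) := (hGc.sup continuousOn_const).pow 2
    have c2 : ContinuousOn (fun x => max (G' x) 0 ^ 2) (Icc (a - δ) (b + δ)) :=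
      (hG'c.sup continuousOn_const).pow 2
    have c3 := c2.mono (Icc_subset_Icc (by linarith : a - δ ≤ a) (by linarith : b ≤ b + δ))
    refine (intervalIntegral.integral_mono_on hab.le (hint hab.le c1) (hint hab.le c3)
      fun x hx => ?_).trans (intervalIntegral.integral_mono_interval (by linarith) hab.le
        (by linarith) (.of_forall fun x => sq_nonneg _) (hint hab'.le c2))
    exact pow_le_pow_left₀ (le_max_right _ _) (max_le_max_right 0 (hGG' x hx)) 2
  rw [hsplit G a b hab.le hGc, hsplit G' _ _ hab'.le hG'c]
  have h1 : t * ((∫ x in a..b, (k x ^ 2 + x ^ 2)) - 24 * R * ω * δ)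
      ≤ t * ∫ x in (a - δ)..(b + δ), (k' x ^ 2 + x ^ 2) := mul_le_mul_of_nonneg_left key ht
  have h2 := mul_le_mul_of_nonneg_left hp ht
  have h3 := mul_le_mul_of_nonneg_right hωη hδ.le
  have h4 : 0 ≤ t * (2 * δ * (t ^ 2 / 12)) := by positivity
  simp only [hk, hk'] at h1
  linarith

end Disc

/-! ### Transfer to the Euclidean plane and monotonicity for one segment -/

lemma normSqMeasure_eq : normSqMeasure
    = volume.withDensity fun x : EuclideanSpace ℝ (Fin 2) => ENNReal.ofReal (‖x‖ ^ 2) := by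
  simp [normSqMeasure, EuclideanSpace.norm_sq_eq]

instance : IsLocallyFiniteMeasure normSqMeasure :=
  IsLocallyFiniteMeasure.withDensity_ofReal (by fun_prop)

/-- Orthonormal coordinates in which the vector `u` is vertical. -/
lemma exists_coordinates (u : EuclideanSpace ℝ (Fin 2)) :
    ∃ Φ : (ℝ × ℝ) ≃L[ℝ] EuclideanSpace ℝ (Fin 2),
      MeasurePreserving Φ prodNormSqMeasure normSqMeasure ∧
      (∀ p, ‖Φ p‖ ^ 2 = p.1 ^ 2 + p.2 ^ 2) ∧ Φ (0, ‖u‖) = u := by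
  set e : EuclideanSpace ℝ (Fin 2) := EuclideanSpace.single 1 ‖u‖ with he
  have hnorm : ‖e‖ = ‖u‖ := by simp [he]
  -- As e and u have equal norms, reflection in the line orthogonal to e - u carries e to u.
  set ρ := (ℝ ∙ (e - u))ᗮ.reflection with hρ
  have hρe : ρ e = u := Submodule.reflection_sub hnorm
  set Ψ : (ℝ × ℝ) ≃L[ℝ] EuclideanSpace ℝ (Fin 2) :=
    (ContinuousLinearEquiv.finTwoArrow ℝ ℝ).symm.trans
      (EuclideanSpace.equiv (Fin 2) ℝ).symm with hΨ
  have hΨm : MeasurePreserving Ψ (volume : Measure (ℝ × ℝ)) volume :=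
    (PiLp.volume_preserving_toLp (Fin 2)).comp
      (volume_preserving_finTwoArrow ℝ).symm
  have hΨn : ∀ p, ‖Ψ p‖ ^ 2 = p.1 ^ 2 + p.2 ^ 2 := fun p => by
    simp [hΨ, EuclideanSpace.norm_sq_eq]
  have hn : ∀ p, ‖ρ (Ψ p)‖ ^ 2 = p.1 ^ 2 + p.2 ^ 2 := fun p => by
    rw [LinearIsometryEquiv.norm_map, hΨn]
  refine ⟨Ψ.trans ρ.toContinuousLinearEquiv, ?_, hn, ?_⟩
  · have hm : MeasurePreserving (fun p => ρ (Ψ p)) (volume : Measure (ℝ × ℝ)) volume :=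
      ρ.measurePreserving.comp hΨm
    refine ⟨hm.measurable, ?_⟩
    ext s hs
    change (Measure.map (fun p => ρ (Ψ p)) prodNormSqMeasure) s = _
    rw [Measure.map_apply hm.measurable hs, normSqMeasure_eq, prodNormSqMeasure,
      withDensity_apply _ hs, withDensity_apply _ (hm.measurable hs),
      ← hm.setLIntegral_comp_preimage hs (by fun_prop)]
    simp only [hn]
  · have : Ψ (0, ‖u‖) = e := by
      ext i
      fin_cases i <;> simp [hΨ, he]
    change ρ (Ψ (0, ‖u‖)) = u
    rw [this, hρe]

lemma exists_image_fst_eq_Icc {C : Set (ℝ × ℝ)} (hC : IsCompact C) (hconv : Convex ℝ C)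
    (hint : (interior C).Nonempty) : ∃ a b, a < b ∧ Prod.fst '' C = Icc a b := by
  have h1 : (Prod.fst '' C).Nonempty := (hint.mono interior_subset).image _
  have h2 : IsConnected (Prod.fst '' C) :=
    ⟨h1, hconv.isPreconnected.image _ continuous_fst.continuousOn⟩
  refine ⟨_, _, ?_, eq_Icc_of_connected_compact h2 (hC.image continuous_fst)⟩
  set a := sInf (Prod.fst '' C)
  set b := sSup (Prod.fst '' C)
  have hI : Prod.fst '' C = Icc a b := eq_Icc_of_connected_compact h2 (hC.image continuous_fst)
  have h3 : (interior (Icc a b)).Nonempty := by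
    rw [← hI]
    exact (hint.image Prod.fst).mono
      (interior_maximal (image_mono interior_subset) (isOpenMap_fst _ isOpen_interior))
  rw [interior_Icc] at h3
  exact nonempty_Ioo.1 h3

lemma isCompact_segment_of_endpoints {E : Type*} [NormedAddCommGroup E] [NormedSpace ℝ E]
    (x y : E) : IsCompact (segment ℝ x y) := by
  rw [← convexHull_pair (𝕜 := ℝ)]
  exact (toFinite {x, y}).isCompact_convexHull ℝ

lemma mem_cthickening_iff_infDist {X : Type*} [PseudoMetricSpace X] {s : Set X} {x : X} {ε : ℝ}
    (hε : 0 ≤ ε) (hs : s.Nonempty) : x ∈ cthickening ε s ↔ infDist x s ≤ ε := by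
  rw [mem_cthickening_iff, infDist, ENNReal.le_ofReal_iff_toReal_le (infEDist_ne_top hs) hε]

section Plane

variable {K : Set (EuclideanSpace ℝ (Fin 2))}

lemma eventually_normSqMeasure_growth (hK : IsConvexBody K) (u : EuclideanSpace ℝ (Fin 2))
    {η : ℝ} (hη : 0 < η) :
    ∀ᶠ δ in 𝓝[>] (0 : ℝ),
      (normSqMeasure.real (K + segment ℝ 0 u) - normSqMeasure.real K) - η * δ
      ≤ normSqMeasure.real (K + closedBall 0 δ + segment ℝ 0 u)
        - normSqMeasure.real (K + closedBall 0 δ) := by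
  obtain ⟨Φ, hΦ, hn, hu⟩ := exists_coordinates u
  have hball : ∀ {δ : ℝ}, 0 ≤ δ → Φ ⁻¹' closedBall 0 δ = prodDisc δ := fun {δ} hδ => by
    ext p
    rw [mem_preimage, mem_closedBall_zero_iff, ← sq_le_sq₀ (norm_nonneg _) hδ, hn]
    rfl
  have hseg : Φ ⁻¹' segment ℝ 0 u = vertSeg ‖u‖ := by
    have h1 : Φ ⁻¹' segment ℝ 0 u = segment ℝ (0 : ℝ × ℝ) (0, ‖u‖) := by
      have h2 : Φ.symm '' segment ℝ 0 u = segment ℝ (Φ.symm 0) (Φ.symm u) :=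
        image_segment ℝ (Φ.symm : EuclideanSpace ℝ (Fin 2) →ₗ[ℝ] ℝ × ℝ).toAffineMap 0 u
      rw [← Φ.image_symm_eq_preimage, h2, map_zero, (Φ.symm_apply_eq).2 hu.symm]
    rw [h1, show (0 : ℝ × ℝ) = (0, 0) from rfl, ← Prod.image_mk_segment_right,
      segment_eq_Icc (norm_nonneg u), vertSeg, singleton_prod]
  have hadd : ∀ A B : Set (EuclideanSpace ℝ (Fin 2)), Φ ⁻¹' (A + B) = Φ ⁻¹' A + Φ ⁻¹' B := by
    intro A B
    simp only [← Φ.image_symm_eq_preimage]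
    exact image_add Φ.symm
  have hreal : ∀ {A : Set (EuclideanSpace ℝ (Fin 2))}, IsCompact A →
      normSqMeasure.real A = prodNormSqMeasure.real (Φ ⁻¹' A) := fun hA => by
    rw [measureReal_def, measureReal_def, hΦ.measure_preimage hA.measurableSet.nullMeasurableSet]
  have hC : IsCompact (Φ ⁻¹' K) := Φ.toHomeomorph.isCompact_preimage.2 hK.isCompact
  have hconv : Convex ℝ (Φ ⁻¹' K) :=
    hK.convex.linear_preimage (Φ : (ℝ × ℝ) →ₗ[ℝ] EuclideanSpace ℝ (Fin 2))
  have hint : (interior (Φ ⁻¹' K)).Nonempty := by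
    have : interior (Φ ⁻¹' K) = Φ ⁻¹' interior K := (Φ.toHomeomorph.preimage_interior K).symm
    rw [this]
    exact hK.interior_nonempty.preimage Φ.surjective
  have hsegc : IsCompact (segment ℝ 0 u) := isCompact_segment_of_endpoints _ _
  obtain ⟨a, b, hab, hI⟩ := exists_image_fst_eq_Icc hC hconv hint
  filter_upwards [eventually_measureReal_add_vertSeg_growth hC hconv hI hab (norm_nonneg u) hη,
    self_mem_nhdsWithin] with δ hδ hδ0
  have hδ0 : 0 < δ := hδ0
  rw [hreal (hK.isCompact.add hsegc), hreal hK.isCompact,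
    hreal ((hK.isCompact.add (isCompact_closedBall _ _)).add hsegc),
    hreal (hK.isCompact.add (isCompact_closedBall _ _))]
  simp only [hadd, hball hδ0.le, hseg]
  exact hδ

/-- Dominated convergence: for ε > 0 the indicator can jump at ε only where the distance to K equals
ε, inside the null frontier of a convex thickening. At ε = 0 only right continuity is required, and
K is closed. -/
lemma continuousOn_normSqMeasure_add_closedBall (hK : IsCompact K) (hconv : Convex ℝ K) :
    ContinuousOn (fun ε => normSqMeasure.real (K + closedBall 0 ε)) (Ici 0) := by
  rcases K.eq_empty_or_nonempty with rfl | hne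
  · simpa using continuousOn_const
  have hthick : ∀ {ε : ℝ}, 0 ≤ ε → K + closedBall 0 ε = cthickening ε K := fun {ε} hε =>
    hK.add_closedBall_zero hε
  have hreal : ∀ ε ∈ Ici (0 : ℝ), normSqMeasure.real (K + closedBall 0 ε)
      = ∫ x, (if infDist x K ≤ ε then (1 : ℝ) else 0) ∂normSqMeasure := by
    intro ε hε
    have hs : MeasurableSet (K + closedBall 0 ε) :=
      (hK.add (isCompact_closedBall _ _)).measurableSet
    rw [← integral_indicator_one hs]
    congr 1
    ext x
    rw [hthick hε]
    by_cases h : x ∈ cthickening ε K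
    · rw [indicator_of_mem h, if_pos ((mem_cthickening_iff_infDist hε hne).1 h)]; rfl
    · rw [indicator_of_notMem h, if_neg fun h' => h ((mem_cthickening_iff_infDist hε hne).2 h')]
  refine ContinuousOn.congr ?_ hreal
  intro ε hε
  have hε : 0 ≤ ε := hε
  have hbig : IsCompact (K + closedBall 0 (ε + 1)) := hK.add (isCompact_closedBall _ _)
  refine continuousWithinAt_of_dominated
    (bound := (K + closedBall 0 (ε + 1)).indicator fun _ => (1 : ℝ)) ?_ ?_ ?_ ?_
  · refine .of_forall fun r => Measurable.aestronglyMeasurable ?_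
    exact Measurable.ite (measurableSet_le (by fun_prop) measurable_const) measurable_const
      measurable_const
  · have : ∀ᶠ r in 𝓝[Ici 0] ε, r ≤ ε + 1 :=
      mem_nhdsWithin_of_mem_nhds (Iic_mem_nhds (by linarith))
    filter_upwards [this, self_mem_nhdsWithin] with r hr hr0
    refine .of_forall fun x => ?_
    split_ifs with h
    · rw [hthick (by linarith), indicator_of_mem
        ((mem_cthickening_iff_infDist (by linarith) hne).2 (h.trans hr))]
      simp
    · simp only [norm_zero]
      exact indicator_nonneg (fun _ _ => zero_le_one) _
  · exact (integrable_indicator_iff hbig.measurableSet).2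
      (integrableOn_const hbig.measure_lt_top.ne)
  · have hnull : ∀ᵐ x ∂normSqMeasure, 0 < ε → infDist x K ≠ ε := by
      rcases hε.eq_or_lt with rfl | hpos
      · exact .of_forall fun x h => absurd h (lt_irrefl _)
      have hfr : normSqMeasure (frontier (thickening ε K)) = 0 :=
        withDensity_absolutelyContinuous _ _ ((hconv.thickening ε).addHaar_frontier volume)
      filter_upwards [measure_eq_zero_iff_ae_notMem.1 hfr] with x hx _ h
      refine hx ⟨?_, ?_⟩
      · rw [closure_thickening hpos, mem_cthickening_iff_infDist hε hne]
        exact h.le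
      · rw [isOpen_thickening.interior_eq, mem_thickening_iff_infDist_lt hne]
        exact not_lt.2 h.ge
    filter_upwards [hnull] with x hx
    by_cases h : infDist x K ≤ ε
    · have hev : ∀ᶠ r in 𝓝[Ici 0] ε, infDist x K ≤ r := by
        rcases hε.eq_or_lt with rfl | hpos
        · filter_upwards [self_mem_nhdsWithin] with r hr using h.trans hr
        · exact mem_nhdsWithin_of_mem_nhds (Ici_mem_nhds (lt_of_le_of_ne h (hx hpos)))
      exact (continuousWithinAt_const (b := (1 : ℝ))).congr_of_eventuallyEq (hev.mono fun r hr => if_pos hr) (if_pos h)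
    · have hev : ∀ᶠ r in 𝓝[Ici 0] ε, ¬ infDist x K ≤ r :=
        mem_nhdsWithin_of_mem_nhds (Filter.mem_of_superset (Iio_mem_nhds (not_le.1 h)) fun r hr => not_le.2 hr)
      exact (continuousWithinAt_const (b := (0 : ℝ))).congr_of_eventuallyEq (hev.mono fun r hr => if_neg hr) (if_neg h)

lemma IsConvexBody.add {K L : Set (EuclideanSpace ℝ (Fin 2))} (hK : IsConvexBody K)
    (hL : IsCompact L) (hLc : Convex ℝ L) (hne : L.Nonempty) : IsConvexBody (K + L) :=
  ⟨hK.isCompact.add hL, hK.convex.add hLc,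
    (hK.interior_nonempty.add hne).mono (interior_maximal (add_subset_add_right interior_subset)
      isOpen_interior.add_right)⟩

/-- Adding a segment that starts at the origin increases the measure of the outer shells. -/
lemma normSqMeasure_shell_add_segment (hK : IsConvexBody K) (u : EuclideanSpace ℝ (Fin 2))
    {ε : ℝ} (hε : 0 ≤ ε) :
    normSqMeasure.real (K + segment ℝ 0 u) - normSqMeasure.real K
      ≤ normSqMeasure.real (K + closedBall 0 ε + segment ℝ 0 u)
        - normSqMeasure.real (K + closedBall 0 ε) := by
  set f : ℝ → ℝ := fun r => normSqMeasure.real (K + closedBall 0 r + segment ℝ 0 u)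
        - normSqMeasure.real (K + closedBall 0 r) with hf
  have hsegc : IsCompact (segment ℝ 0 u) := isCompact_segment_of_endpoints _ _
  have hcont : ContinuousOn f (Ici 0) := by
    have h1 := continuousOn_normSqMeasure_add_closedBall (hK.isCompact.add hsegc)
      (hK.convex.add (convex_segment 0 u))
    refine (h1.congr fun r _ => ?_).sub
      (continuousOn_normSqMeasure_add_closedBall hK.isCompact hK.convex)
    rw [add_right_comm]
  -- A continuous function with nonnegative lower right derivative is monotone. The estimate at 0
  -- applies at every x because (K + xB) + (z - x)B = K + zB and K + xB is again a convex body.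
  have key : ∀ x ∈ Icc 0 ε, -f x ≤ -f 0 := by
    refine image_le_of_liminf_slope_right_le_deriv_boundary (f := fun x => -f x) (B := fun _ => -f 0)
      (B' := fun _ => 0) (hcont.neg.mono Icc_subset_Ici_self) le_rfl continuousOn_const
      (fun x _ => hasDerivWithinAt_const _ _ _) fun x hx r hr => ?_
    have hx0 : 0 ≤ x := hx.1
    have hKx : IsConvexBody (K + closedBall 0 x) :=
      hK.add (isCompact_closedBall _ _) (convex_closedBall _ _) (nonempty_closedBall.2 hx0)
    have ht : Tendsto (fun z : ℝ => z - x) (𝓝[>] x) (𝓝[>] 0) := by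
      refine tendsto_nhdsWithin_iff.2 ⟨?_, ?_⟩
      · have : Tendsto (fun z : ℝ => z - x) (𝓝 x) (𝓝 (x - x)) := by
          exact (continuous_id.sub continuous_const).tendsto x
        rw [sub_self] at this
        exact this.mono_left nhdsWithin_le_nhds
      · filter_upwards [self_mem_nhdsWithin] with z hz using sub_pos.2 (mem_Ioi.1 hz)
    refine Eventually.frequently ?_
    filter_upwards [ht.eventually (eventually_normSqMeasure_growth hKx u (half_pos hr)),
      self_mem_nhdsWithin] with z hz hzx
    have hzx : x < z := hzx
    have hadd : K + closedBall (0 : EuclideanSpace ℝ (Fin 2)) x + closedBall 0 (z - x)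
        = K + closedBall 0 z := by
      rw [add_assoc, closedBall_add_closedBall hx0 (sub_nonneg.2 hzx.le), add_zero,
        add_sub_cancel]
    rw [hadd] at hz
    rw [slope_def_field, div_lt_iff₀ (sub_pos.2 hzx)]
    have h2 : r / 2 * (z - x) < r * (z - x) :=
      mul_lt_mul_of_pos_right (by linarith) (sub_pos.2 hzx)
    simp only [hf]
    linarith
  have := key ε ⟨hε, le_rfl⟩
  have h0 : f 0 = normSqMeasure.real (K + segment ℝ 0 u) - normSqMeasure.real K := by
    simp [hf]
  rw [← h0]
  linarith

end Plane

/-! ### Interpolation of periodic support functions by zonotopes -/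

/-- Under these bounds no kink of |sin| lies strictly between y - α and y + α, so |sin| satisfies
the oscillator identity of sin there. -/
lemma abs_sin_sub_add_abs_sin_add {α y : ℝ} (hα : 0 ≤ α) (h1 : α ≤ |y|) (h2 : |y| ≤ Real.pi - α) :
    |Real.sin (y - α)| + |Real.sin (y + α)| = 2 * Real.cos α * |Real.sin y| := by
  wlog hy : 0 ≤ y generalizing y
  · have := this (y := -y) (by rwa [abs_neg]) (by rwa [abs_neg]) (by linarith)
    rw [show -y - α = -(y + α) by ring, show -y + α = -(y - α) by ring] at this
    simp only [Real.sin_neg, abs_neg] at this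
    linarith
  rw [abs_of_nonneg hy] at h1 h2
  rw [abs_of_nonneg (Real.sin_nonneg_of_nonneg_of_le_pi (by linarith) (by linarith)),
    abs_of_nonneg (Real.sin_nonneg_of_nonneg_of_le_pi (by linarith) (by linarith)),
    abs_of_nonneg (Real.sin_nonneg_of_nonneg_of_le_pi hy (by linarith)), Real.sin_sub, Real.sin_add]
  ring

lemma mul_sin_eq_of_recurrence {e : ℕ → ℝ} {α : ℝ} {N : ℕ}
    (he : ∀ i < N, e (i + 2) = 2 * Real.cos α * e (i + 1) - e i) :
    ∀ i ≤ N, e i * Real.sin α = e 1 * Real.sin (i * α) - e 0 * Real.sin ((i - 1) * α) ∧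
      e (i + 1) * Real.sin α = e 1 * Real.sin ((i + 1) * α) - e 0 * Real.sin (i * α) := by
  intro i
  induction i with
  | zero => intro _; simp
  | succ i ih =>
    intro hi
    obtain ⟨h1, h2⟩ := ih (by omega)
    refine ⟨by push_cast; rw [h2]; ring_nf, ?_⟩
    have h3 := he i (by omega)
    push_cast
    have e1 : Real.sin ((i + 1 + 1) * α)
        = 2 * Real.cos α * Real.sin ((i + 1) * α) - Real.sin (i * α) := by
      rw [show ((i : ℝ) + 1 + 1) * α = (i + 1) * α + α by ring,
        show (i : ℝ) * α = (i + 1) * α - α by ring, Real.sin_add, Real.sin_sub]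
      ring
    have e2 : Real.sin ((i + 1) * α)
        = 2 * Real.cos α * Real.sin (i * α) - Real.sin ((i - 1) * α) := by
      rw [show ((i : ℝ) + 1) * α = i * α + α by ring,
        show ((i : ℝ) - 1) * α = i * α - α by ring, Real.sin_add, Real.sin_sub]
      ring
    rw [h3, e1, sub_mul, h1, mul_assoc, h2]
    linear_combination e 0 * e2

/-- A solution of the discrete oscillator equation that is periodic with half the natural period
vanishes. -/
lemma eq_zero_of_recurrence_of_periodic {e : ℕ → ℝ} {N : ℕ} (hN : 2 ≤ N)
    (he : ∀ i < N, e (i + 2) = 2 * Real.cos (Real.pi / N) * e (i + 1) - e i)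
    (h0 : e N = e 0) (h1 : e (N + 1) = e 1) : ∀ i ≤ N, e i = 0 := by
  have hN0 : (N : ℝ) ≠ 0 := by positivity
  have hNpi : (N : ℝ) * (Real.pi / N) = Real.pi := by field_simp
  have hs : 0 < Real.sin (Real.pi / N) := by
    refine Real.sin_pos_of_pos_of_lt_pi (by positivity) (div_lt_self Real.pi_pos ?_)
    exact_mod_cast hN
  have key := mul_sin_eq_of_recurrence he
  obtain ⟨k1, k2⟩ := key N le_rfl
  -- N steps of angle π/N amount to half a period, which flips the sign of any solution; periodicity
  -- then forces e 0 = -e 0, and likewise for e 1.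
  rw [sub_mul, one_mul, hNpi, Real.sin_pi, Real.sin_pi_sub, h0] at k1
  rw [add_mul, one_mul, hNpi, Real.sin_pi, add_comm Real.pi, Real.sin_add_pi, h1] at k2
  have z0 : e 0 = 0 := by
    have : e 0 * Real.sin (Real.pi / N) = 0 := by linarith
    exact (mul_eq_zero.1 this).resolve_right hs.ne'
  have z1 : e 1 = 0 := by
    have : e 1 * Real.sin (Real.pi / N) = 0 := by linarith
    exact (mul_eq_zero.1 this).resolve_right hs.ne'
  intro i hi
  have := (key i hi).1
  rw [z0, z1, zero_mul, zero_mul, sub_zero] at this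
  exact (mul_eq_zero.1 this).resolve_right hs.ne'

lemma abs_abs_sin_sub_le (x y : ℝ) : |(|Real.sin x| - |Real.sin y|)| ≤ |x - y| :=
  (abs_abs_sub_abs_le _ _).trans (by
    have := Real.lipschitzWith_sin.dist_le_mul x y
    simpa [Real.dist_eq] using this)

section Weights

variable {h : ℝ → ℝ} {N : ℕ}

/-- The half edge lengths of the polygon circumscribed about a planar body with support function
`h`, with `2 * N` normals at equal angles. -/
noncomputable def edgeWeight (h : ℝ → ℝ) (N k : ℕ) : ℝ :=
  (h (k * (Real.pi / N) - Real.pi / N) + h (k * (Real.pi / N) + Real.pi / N)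
    - 2 * Real.cos (Real.pi / N) * h (k * (Real.pi / N))) / (2 * Real.sin (Real.pi / N))

/-- The support function of the zonotope with half edges `edgeWeight`. -/
noncomputable def zonotopeSupport (h : ℝ → ℝ) (N : ℕ) (θ : ℝ) : ℝ :=
  ∑ k ∈ Finset.range N, edgeWeight h N k * |Real.sin (θ - k * (Real.pi / N))|

lemma sin_pi_div_pos (hN : 2 ≤ N) : 0 < Real.sin (Real.pi / N) := by
  have : (0 : ℝ) < N := by positivity
  refine Real.sin_pos_of_pos_of_lt_pi (by positivity) (div_lt_self Real.pi_pos ?_)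
  exact_mod_cast hN

/-- `hconv` is sublinearity of a support function, tested on the unit vectors at angles θ - φ and θ
+ φ, whose sum is 2 cos φ times the one at angle θ. -/
lemma edgeWeight_nonneg (hN : 2 ≤ N)
    (hconv : ∀ θ φ, 2 * Real.cos φ * h θ ≤ h (θ - φ) + h (θ + φ)) (k : ℕ) :
    0 ≤ edgeWeight h N k :=
  div_nonneg (sub_nonneg.2 (hconv _ _)) (by linarith [sin_pi_div_pos hN])

lemma zonotopeSupport_periodic (θ : ℝ) :
    zonotopeSupport h N (θ + Real.pi) = zonotopeSupport h N θ := by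
  refine Finset.sum_congr rfl fun k _ => ?_
  rw [add_sub_right_comm, Real.sin_add_pi, abs_neg]

/-- Every generator except the i-th is free of kinks around node i and drops out. The i-th
contributes 2 sin(π/N) times its weight, which is how the weights were normalised. -/
lemma zonotopeSupport_second_difference (hN : 2 ≤ N) {i : ℕ} (hi : i < N) :
    zonotopeSupport h N (i * (Real.pi / N) - Real.pi / N)
      + zonotopeSupport h N (i * (Real.pi / N) + Real.pi / N)
      - 2 * Real.cos (Real.pi / N) * zonotopeSupport h N (i * (Real.pi / N))
      = h (i * (Real.pi / N) - Real.pi / N) + h (i * (Real.pi / N) + Real.pi / N)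
        - 2 * Real.cos (Real.pi / N) * h (i * (Real.pi / N)) := by
  have hs := sin_pi_div_pos hN
  have hN0 : (0 : ℝ) < N := by positivity
  set α := Real.pi / N with hα
  have hα0 : 0 < α := by positivity
  have hNα : N * α = Real.pi := by rw [hα]; field_simp
  simp only [zonotopeSupport, ← hα]
  rw [Finset.mul_sum, ← Finset.sum_add_distrib, ← Finset.sum_sub_distrib,
    Finset.sum_eq_single_of_mem i (Finset.mem_range.2 hi)]
  · simp only [edgeWeight, ← hα, sub_self, Real.sin_zero, abs_zero, mul_zero, sub_zero]
    rw [show (i : ℝ) * α - α - i * α = -α by ring, show (i : ℝ) * α + α - i * α = α by ring,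
      Real.sin_neg, abs_neg, abs_of_pos hs]
    field_simp
    ring
  · intro k hk hki
    rw [Finset.mem_range] at hk
    have hd : (1 : ℝ) ≤ |(i : ℝ) - k| ∧ |(i : ℝ) - k| ≤ N - 1 := by
      have h1 : (1 : ℤ) ≤ |(i : ℤ) - k| ∧ |(i : ℤ) - k| ≤ N - 1 := by
        exact ⟨Int.one_le_abs (by omega), abs_le.2 ⟨by omega, by omega⟩⟩
      exact_mod_cast h1
    have habs : |(i : ℝ) * α - k * α| = |(i : ℝ) - k| * α := by
      rw [← sub_mul, abs_mul, abs_of_pos hα0]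
    have key := abs_sin_sub_add_abs_sin_add (y := i * α - k * α) hα0.le
      (by rw [habs]; nlinarith) (by rw [habs]; nlinarith)
    rw [show (i : ℝ) * α - α - k * α = i * α - k * α - α by ring,
      show (i : ℝ) * α + α - k * α = i * α - k * α + α by ring]
    linear_combination (edgeWeight h N k) * key

/-- The interpolation error is π-periodic and its node values solve the homogeneous oscillator
recurrence, so they vanish. -/
lemma zonotopeSupport_eq (hN : 2 ≤ N) (hper : ∀ θ, h (θ + Real.pi) = h θ) {j : ℕ} (hj : j < N) :
    zonotopeSupport h N (j * (Real.pi / N)) = h (j * (Real.pi / N)) := by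
  have hN0 : (0 : ℝ) < N := by positivity
  set E : ℝ → ℝ := fun θ => zonotopeSupport h N θ - h θ with hE
  have hEp : ∀ θ, E (θ + Real.pi) = E θ := fun θ => by
    simp only [hE, zonotopeSupport_periodic, hper]
  have hNα : N * (Real.pi / N) = Real.pi := by field_simp
  -- The sequence starts at node -1, so that its N recurrences are the second differences at the
  -- nodes 0, …, N - 1.
  have key := eq_zero_of_recurrence_of_periodic (e := fun i => E ((i - 1) * (Real.pi / N))) hN
    (fun i hi => by
      have := zonotopeSupport_second_difference (h := h) hN hi
      simp only [hE]
      push_cast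
      rw [show ((i : ℝ) + 2 - 1) * (Real.pi / N) = i * (Real.pi / N) + Real.pi / N by ring,
        show ((i : ℝ) + 1 - 1) * (Real.pi / N) = i * (Real.pi / N) by ring,
        show ((i : ℝ) - 1) * (Real.pi / N) = i * (Real.pi / N) - Real.pi / N by ring]
      linarith)
    (by
      rw [sub_mul, hNα, ← hEp ((((0 : ℕ) : ℝ) - 1) * (Real.pi / N))]
      congr 1
      push_cast
      ring)
    (by
      rw [← hEp ((((1 : ℕ) : ℝ) - 1) * (Real.pi / N))]
      push_cast
      rw [sub_mul, add_mul, hNα]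
      congr 1
      ring)
    (j + 1) hj
  simp only [hE] at key
  push_cast at key
  rw [add_sub_cancel_right] at key
  linarith

/-- Approximation of the support function of a symmetric planar body by that of a zonotope. -/
lemma exists_zonotope_support {R : ℝ} (hper : ∀ θ, h (θ + Real.pi) = h θ)
    (hconv : ∀ θ φ, 2 * Real.cos φ * h θ ≤ h (θ - φ) + h (θ + φ)) (hR : ∀ θ, h θ ≤ R)
    (hLip : ∀ θ φ, |h θ - h φ| ≤ R * |θ - φ|) {η : ℝ} (hη : 0 < η) :
    ∃ N : ℕ, ∃ w ψ : ℕ → ℝ, (∀ k, 0 ≤ w k) ∧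
      ∀ θ, |(∑ k ∈ Finset.range N, w k * |Real.sin (θ - ψ k)|) - h θ| ≤ η := by
  -- An even number N = 2M of steps makes π/2 a node. The 3R is the sum of the Lipschitz constants,
  -- 2R for the zonotope and R for h.
  obtain ⟨M, hM⟩ := exists_nat_gt (max 1 (3 * R * Real.pi / η))
  have hM1 : (1 : ℝ) < M := (le_max_left _ _).trans_lt hM
  have hM2 : 3 * R * Real.pi / η < M := (le_max_right _ _).trans_lt hM
  have hM1' : 1 < M := by exact_mod_cast hM1
  set N := 2 * M with hNM
  have hN : 2 ≤ N := by omega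
  have hN0 : (0 : ℝ) < N := by positivity
  have hNR : (N : ℝ) = 2 * M := by simp [hNM]
  set α := Real.pi / N with hα
  have hα0 : 0 < α := by positivity
  have hw : ∀ k, 0 ≤ edgeWeight h N k := edgeWeight_nonneg hN hconv
  have hR0 : 0 ≤ R := by
    have := (abs_nonneg _).trans (hLip 1 0)
    simpa using this
  refine ⟨N, edgeWeight h N, fun k => k * α, hw, ?_⟩
  change ∀ θ, |zonotopeSupport h N θ - h θ| ≤ η
  have hgrid : ∀ j : ℕ, j < N → zonotopeSupport h N (j * α) = h (j * α) :=
    fun j hj => zonotopeSupport_eq hN hper hj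
  have hsum : ∑ k ∈ Finset.range N, edgeWeight h N k ≤ 2 * R := by
    have h1 := (hgrid 0 (by omega)).trans_le (hR _)
    have h2 := (hgrid M (by omega)).trans_le (hR _)
    have hMα : (M : ℝ) * α = Real.pi / 2 := by rw [hα, hNR]; field_simp
    rw [hMα] at h2
    -- Since |sin| + |cos| ≥ 1, two perpendicular directions control the total weight.
    have h3 : ∑ k ∈ Finset.range N, edgeWeight h N k
        ≤ zonotopeSupport h N ((0 : ℕ) * α) + zonotopeSupport h N (Real.pi / 2) := by
      rw [zonotopeSupport, zonotopeSupport, ← Finset.sum_add_distrib]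
      refine Finset.sum_le_sum fun k _ => ?_
      rw [← mul_add]
      refine le_mul_of_one_le_right (hw k) ?_
      rw [← hα]
      push_cast
      rw [zero_mul, zero_sub, Real.sin_neg, abs_neg, Real.sin_pi_div_two_sub]
      have h4 := Real.sin_sq_add_cos_sq (k * α)
      rw [← sq_abs (Real.sin _), ← sq_abs (Real.cos _)] at h4
      nlinarith [abs_nonneg (Real.sin (k * α)), abs_nonneg (Real.cos (k * α)),
        mul_nonneg (abs_nonneg (Real.sin (k * α))) (abs_nonneg (Real.cos (k * α)))]
    exact h3.trans ((add_le_add h1 h2).trans_eq (by ring))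
  have hLipZ : ∀ θ φ, |zonotopeSupport h N θ - zonotopeSupport h N φ| ≤ 2 * R * |θ - φ| := by
    intro θ φ
    rw [zonotopeSupport, zonotopeSupport, ← Finset.sum_sub_distrib]
    refine (Finset.abs_sum_le_sum_abs _ _).trans ?_
    refine le_trans ?_ (mul_le_mul_of_nonneg_right hsum (abs_nonneg _))
    rw [Finset.sum_mul]
    refine Finset.sum_le_sum fun k _ => ?_
    rw [← mul_sub, abs_mul, abs_of_nonneg (hw k)]
    refine mul_le_mul_of_nonneg_left ?_ (hw k)
    have := abs_abs_sin_sub_le (θ - k * (Real.pi / N)) (φ - k * (Real.pi / N))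
    rwa [sub_sub_sub_cancel_right] at this
  intro θ
  have hEper : Function.Periodic (fun θ => |zonotopeSupport h N θ - h θ|) Real.pi := fun θ => by
    simp only [zonotopeSupport_periodic, hper]
  obtain ⟨θ', hθ', heq⟩ := hEper.exists_mem_Ico₀ Real.pi_pos θ
  rw [heq]
  have hq0 : 0 ≤ θ' / α := div_nonneg hθ'.1 hα0.le
  set j := ⌊θ' / α⌋₊ with hj
  have hj1 : (j : ℝ) ≤ θ' / α := Nat.floor_le hq0
  have hj2 : θ' / α < j + 1 := Nat.lt_floor_add_one _
  rw [le_div_iff₀ hα0] at hj1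
  rw [div_lt_iff₀ hα0] at hj2
  have hNα : N * α = Real.pi := by rw [hα]; field_simp
  have hjN : j < N := by
    have : (j : ℝ) * α < N * α := by rw [hNα]; linarith [hθ'.2]
    exact_mod_cast lt_of_mul_lt_mul_right this hα0.le
  have hdist : |θ' - j * α| ≤ α := by rw [abs_le]; constructor <;> linarith
  have hZ := (hLipZ θ' (j * α)).trans (mul_le_mul_of_nonneg_left hdist (by positivity))
  have hH := (hLip (j * α) θ').trans
    (mul_le_mul_of_nonneg_left ((abs_sub_comm _ _).trans_le hdist) hR0)
  have hsmall : 3 * R * α ≤ η := by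
    rw [div_lt_iff₀ hη] at hM2
    rw [hα, ← mul_div_assoc, div_le_iff₀ hN0, hNR]
    nlinarith
  have hdec : zonotopeSupport h N θ' - h θ' = (zonotopeSupport h N θ' - zonotopeSupport h N (j * α))
      + (h (j * α) - h θ') := by rw [hgrid j hjN]; ring
  rw [hdec]
  refine (abs_add_le _ _).trans ?_
  linarith

end Weights

/-! ### Inclusions from support functions -/

section AngleVec

/-- The unit vector with polar angle `θ`. -/
noncomputable def angleVec (θ : ℝ) : EuclideanSpace ℝ (Fin 2) := !₂[Real.cos θ, Real.sin θ]

lemma inner_angleVec_angleVec (θ φ : ℝ) :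
    inner ℝ (angleVec θ) (angleVec φ) = Real.cos (θ - φ) := by
  simp [angleVec, PiLp.inner_apply, Fin.sum_univ_two, Real.cos_sub]
  ring

lemma norm_angleVec (θ : ℝ) : ‖angleVec θ‖ = 1 := by
  rw [norm_eq_sqrt_real_inner, inner_angleVec_angleVec]
  simp

lemma angleVec_add_pi (θ : ℝ) : angleVec (θ + Real.pi) = -angleVec θ := by
  ext i
  fin_cases i <;> simp [angleVec]

lemma angleVec_sub_add_angleVec_add (θ φ : ℝ) :
    angleVec (θ - φ) + angleVec (θ + φ) = (2 * Real.cos φ) • angleVec θ := by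
  ext i
  fin_cases i
  · simp [angleVec, Real.cos_sub, Real.cos_add]
    ring
  · simp [angleVec, Real.sin_sub, Real.sin_add]
    ring

lemma exists_eq_norm_smul_angleVec (w : EuclideanSpace ℝ (Fin 2)) :
    ∃ θ, w = ‖w‖ • angleVec θ := by
  refine ⟨Complex.arg ⟨w 0, w 1⟩, ?_⟩
  have hn : ‖(⟨w 0, w 1⟩ : ℂ)‖ = ‖w‖ := by
    rw [EuclideanSpace.norm_eq, Complex.norm_eq_sqrt_sq_add_sq]
    simp
  ext i
  fin_cases i
  · simp [angleVec, ← hn, Complex.norm_mul_cos_arg]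
  · simp [angleVec, ← hn, Complex.norm_mul_sin_arg]

lemma norm_angleVec_sub_le (θ φ : ℝ) : ‖angleVec θ - angleVec φ‖ ≤ 2 * |θ - φ| := by
  rw [← sq_le_sq₀ (norm_nonneg _) (by positivity), EuclideanSpace.norm_sq_eq, Fin.sum_univ_two]
  have h1 : |Real.cos θ - Real.cos φ| ≤ |θ - φ| := by
    simpa [Real.dist_eq] using Real.lipschitzWith_cos.dist_le_mul θ φ
  have h2 : |Real.sin θ - Real.sin φ| ≤ |θ - φ| := by
    simpa [Real.dist_eq] using Real.lipschitzWith_sin.dist_le_mul θ φ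
  have h3 := sq_le_sq' (by linarith [abs_nonneg (Real.cos θ - Real.cos φ), abs_nonneg (θ - φ)]) h1
  have h4 := sq_le_sq' (by linarith [abs_nonneg (Real.sin θ - Real.sin φ), abs_nonneg (θ - φ)]) h2
  simp only [angleVec, PiLp.sub_apply, Real.norm_eq_abs]
  simp
  rw [sq_abs] at h3 h4
  nlinarith [sq_nonneg (|θ - φ|), sq_abs (θ - φ)]

/-- Comparison of support functions gives inclusion. -/
lemma subset_add_closedBall_of_inner_le {A B : Set (EuclideanSpace ℝ (Fin 2))} {η : ℝ}
    (hη : 0 ≤ η) (hB : IsCompact B) (hBc : Convex ℝ B)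
    (h : ∀ θ, ∀ x ∈ A, ∃ y ∈ B, inner ℝ (angleVec θ) x ≤ inner ℝ (angleVec θ) y + η) :
    A ⊆ B + closedBall 0 η := by
  intro x hx
  by_contra hn
  obtain ⟨f, c, hf, hfx⟩ := geometric_hahn_banach_closed_point
    (hBc.add (convex_closedBall _ _)) (hB.add (isCompact_closedBall _ _)).isClosed hn
  set w := (InnerProductSpace.toDual ℝ (EuclideanSpace ℝ (Fin 2))).symm f with hw
  have hfw : ∀ y, f y = inner ℝ w y := fun y =>
    (InnerProductSpace.toDual_symm_apply (x := y) (y := f)).symm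
  obtain ⟨θ, hθ⟩ := exists_eq_norm_smul_angleVec w
  obtain ⟨y, hy, hxy⟩ := h θ x hx
  have hmem : y + η • angleVec θ ∈ B + closedBall 0 η :=
    ⟨y, hy, η • angleVec θ, by
      rw [mem_closedBall_zero_iff, norm_smul, norm_angleVec, mul_one, Real.norm_of_nonneg hη], rfl⟩
  have h1 := (hf _ hmem).trans hfx
  rw [hfw, hfw, hθ, real_inner_smul_left, real_inner_smul_left, inner_add_right,
    real_inner_smul_right, inner_angleVec_angleVec, sub_self, Real.cos_zero, mul_one] at h1
  exact absurd (mul_le_mul_of_nonneg_left hxy (norm_nonneg w)) (not_le.2 h1)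

end AngleVec

/-! ### Approximation by sums of segments from the origin -/

section Zonotope

variable {E : Type*} [AddCommGroup E] [Module ℝ E]

/-- Splitting a segment at z into its two arms lets any point of a sum of segments be moved to the
origin, with all new segments starting there. -/
lemma segment_eq_add_add_singleton {x y z : E} (hz : z ∈ segment ℝ x y) :
    segment ℝ 0 (x - z) + segment ℝ 0 (y - z) + {z} = segment ℝ x y := by
  simp only [segment_eq_image', sub_zero, zero_add] at hz ⊢
  obtain ⟨s, hs, rfl⟩ := hz
  ext p
  constructor
  · rintro ⟨_, ⟨_, ⟨σ, hσ, rfl⟩, _, ⟨τ, hτ, rfl⟩, rfl⟩, _, rfl, rfl⟩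
    refine ⟨s - σ * s + τ * (1 - s), ⟨?_, ?_⟩, by simp only; module⟩
    · nlinarith [mul_nonneg hτ.1 (sub_nonneg.2 hs.2), mul_nonneg (sub_nonneg.2 hσ.2) hs.1]
    · nlinarith [mul_nonneg (sub_nonneg.2 hτ.2) (sub_nonneg.2 hs.2), mul_nonneg hσ.1 hs.1]
  · rintro ⟨r, hr, rfl⟩
    rcases le_total r s with h | h
    · have hq : (s - r) / s * s = s - r := by
        rcases hs.1.eq_or_lt with h0 | h0
        · rw [← h0]; linarith [hr.1]
        · field_simp
      refine ⟨_, ⟨_, ⟨(s - r) / s, ⟨div_nonneg (by linarith) hs.1,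
        div_le_one_of_le₀ (by linarith [hr.1]) hs.1⟩, rfl⟩, _, ⟨0, ⟨le_rfl, zero_le_one⟩, rfl⟩, rfl⟩,
        _, rfl, ?_⟩
      have : ((s - r) / s) • (x - (x + s • (y - x))) = (-((s - r) / s * s)) • (y - x) := by module
      simp only [this, hq]
      module
    · have hq : (r - s) / (1 - s) * (1 - s) = r - s := by
        rcases hs.2.eq_or_lt with h0 | h0
        · rw [h0]; linarith [hr.2]
        · have : 1 - s ≠ 0 := by linarith
          field_simp
      refine ⟨_, ⟨_, ⟨0, ⟨le_rfl, zero_le_one⟩, rfl⟩, _, ⟨(r - s) / (1 - s),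
        ⟨div_nonneg (by linarith) (by linarith [hs.2]),
        div_le_one_of_le₀ (by linarith [hr.2]) (by linarith [hs.2])⟩, rfl⟩, rfl⟩,
        _, rfl, ?_⟩
      have : ((r - s) / (1 - s)) • (y - (x + s • (y - x)))
          = ((r - s) / (1 - s) * (1 - s)) • (y - x) := by module
      simp only [this, hq]
      module

/-- The finite Minkowski sums of segments with one end point at the origin. -/
def segmentSums (E : Type*) [AddCommGroup E] [Module ℝ E] : AddSubmonoid (Set E) :=
  AddSubmonoid.closure (range fun u : E => segment ℝ 0 u)

lemma exists_mem_segmentSums_add_singleton {ι : Type*} (s : Finset ι) (x y : ι → E) {z : E}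
    (hz : z ∈ ∑ k ∈ s, segment ℝ (x k) (y k)) :
    ∃ A ∈ segmentSums E, A + {z} = ∑ k ∈ s, segment ℝ (x k) (y k) := by
  rw [mem_finsetSum] at hz
  obtain ⟨g, hg, rfl⟩ := hz
  refine ⟨∑ k ∈ s, (segment ℝ 0 (x k - g k) + segment ℝ 0 (y k - g k)), ?_, ?_⟩
  · exact sum_mem fun k _ => add_mem (AddSubmonoid.subset_closure ⟨_, rfl⟩)
      (AddSubmonoid.subset_closure ⟨_, rfl⟩)
  · have h1 : ({∑ k ∈ s, g k} : Set E) = ∑ k ∈ s, ({g k} : Set E) :=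
      map_sum (singletonAddMonoidHom : E →+ Set E) g s
    rw [h1, ← Finset.sum_add_distrib]
    exact Finset.sum_congr rfl fun k hk => segment_eq_add_add_singleton (hg hk)

end Zonotope

lemma isCompact_sum_segment {ι : Type*} (s : Finset ι) (x y : ι → EuclideanSpace ℝ (Fin 2)) :
    IsCompact (∑ k ∈ s, segment ℝ (x k) (y k)) :=
  Finset.sum_induction _ IsCompact (fun _ _ => IsCompact.add) isCompact_singleton
    fun _ _ => isCompact_segment_of_endpoints _ _

lemma convex_sum_segment {ι : Type*} (s : Finset ι) (x y : ι → EuclideanSpace ℝ (Fin 2)) :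
    Convex ℝ (∑ k ∈ s, segment ℝ (x k) (y k)) :=
  Finset.sum_induction _ (Convex ℝ) (fun _ _ => Convex.add) (convex_singleton 0)
    fun _ _ => convex_segment _ _

lemma inner_le_abs_inner_of_mem_segment {v x n : EuclideanSpace ℝ (Fin 2)}
    (hx : x ∈ segment ℝ (-v) v) : inner ℝ n x ≤ |inner ℝ n v| := by
  obtain ⟨a, b, ha, hb, hab, rfl⟩ := hx
  rw [inner_add_right, real_inner_smul_right, real_inner_smul_right, inner_neg_right]
  have h1 := neg_le_abs (inner ℝ n v)
  have h2 := le_abs_self (inner ℝ n v)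
  calc _ ≤ a * |inner ℝ n v| + b * |inner ℝ n v| := by gcongr
    _ = _ := by rw [← add_mul, hab, one_mul]

/-- A planar compact convex set that is symmetric about the origin is close to a sum of symmetric
segments. -/
lemma exists_sum_segment_approx {L : Set (EuclideanSpace ℝ (Fin 2))} (hL : IsCompact L)
    (hLc : Convex ℝ L) (hne : L.Nonempty) (hsymm : IsSymmetric L) {η : ℝ} (hη : 0 < η) :
    ∃ (N : ℕ) (v : ℕ → EuclideanSpace ℝ (Fin 2)),
      L ⊆ ∑ k ∈ Finset.range N, segment ℝ (-v k) (v k) + closedBall 0 η ∧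
      ∑ k ∈ Finset.range N, segment ℝ (-v k) (v k) ⊆ L + closedBall 0 η := by
  have hmax : ∀ θ, ∃ x ∈ L, ∀ y ∈ L, inner ℝ (angleVec θ) y ≤ inner ℝ (angleVec θ) x := by
    intro θ
    obtain ⟨x, hx, hmax⟩ := hL.exists_isMaxOn (f := fun y => inner ℝ (angleVec θ) y) hne
      (by fun_prop)
    exact ⟨x, hx, isMaxOn_iff.1 hmax⟩
  choose X hXL hX using hmax
  set h : ℝ → ℝ := fun θ => inner ℝ (angleVec θ) (X θ) with hh
  obtain ⟨R, hR0, hR⟩ : ∃ R > 0, ∀ x ∈ L, ‖x‖ ≤ R := hL.isBounded.exists_pos_norm_le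
  have hneg : ∀ {x}, x ∈ L → -x ∈ L := fun {x} hx => by
    have : x ∈ -L := by rwa [← hsymm]
    exact this
  have hper : ∀ θ, h (θ + Real.pi) = h θ := by
    intro θ
    simp only [hh]
    refine le_antisymm ?_ ?_
    · have := hX θ _ (hneg (hXL (θ + Real.pi)))
      rwa [inner_neg_right, ← inner_neg_left, ← angleVec_add_pi] at this
    · have := hX (θ + Real.pi) _ (hneg (hXL θ))
      rwa [angleVec_add_pi, inner_neg_neg, ← angleVec_add_pi] at this
  have hle : ∀ θ φ, h θ - h φ ≤ 2 * R * |θ - φ| := by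
    intro θ φ
    have h1 : h θ - h φ ≤ inner ℝ (angleVec θ - angleVec φ) (X θ) := by
      rw [inner_sub_left]
      linarith [hX φ _ (hXL θ)]
    refine h1.trans ((real_inner_le_norm _ _).trans ?_)
    calc ‖angleVec θ - angleVec φ‖ * ‖X θ‖ ≤ 2 * |θ - φ| * R :=
          mul_le_mul (norm_angleVec_sub_le θ φ) (hR _ (hXL θ)) (norm_nonneg _) (by positivity)
      _ = _ := by ring
  obtain ⟨N, w, ψ, hw, hψ⟩ := exists_zonotope_support (h := h) (R := 2 * R) hper
    (fun θ φ => by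
      have h1 := hX (θ - φ) _ (hXL θ)
      have h2 := hX (θ + φ) _ (hXL θ)
      have h3 : inner ℝ (angleVec (θ - φ)) (X θ) + inner ℝ (angleVec (θ + φ)) (X θ)
          = 2 * Real.cos φ * h θ := by
        rw [← inner_add_left, angleVec_sub_add_angleVec_add, real_inner_smul_left]
      linarith)
    (fun θ => by
      refine (real_inner_le_norm _ _).trans ?_
      rw [norm_angleVec, one_mul]
      linarith [hR _ (hXL θ)])
    (fun θ φ => abs_sub_le_iff.2 ⟨hle θ φ, by rw [abs_sub_comm]; exact hle φ θ⟩) hη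
  -- The quarter turn converts the cosine of the inner product into the sine of the zonotope support
  -- function.
  set v : ℕ → EuclideanSpace ℝ (Fin 2) := fun k => w k • angleVec (ψ k + Real.pi / 2) with hv
  have hinner : ∀ θ k, |inner ℝ (angleVec θ) (v k)| = w k * |Real.sin (θ - ψ k)| := fun θ k => by
    rw [hv, real_inner_smul_right, inner_angleVec_angleVec, ← sub_sub, Real.cos_sub_pi_div_two,
      abs_mul, abs_of_nonneg (hw k)]
  refine ⟨N, v, ?_, ?_⟩
  · refine subset_add_closedBall_of_inner_le hη.le (isCompact_sum_segment _ _ _)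
      (convex_sum_segment _ _ _) fun θ x hx => ?_
    have hk : ∀ k, ∃ y ∈ segment ℝ (-v k) (v k),
        inner ℝ (angleVec θ) y = |inner ℝ (angleVec θ) (v k)| := fun k => by
      rcases abs_choice (inner ℝ (angleVec θ) (v k)) with h' | h'
      · exact ⟨v k, right_mem_segment _ _ _, h'.symm⟩
      · exact ⟨-v k, left_mem_segment _ _ _, by rw [h', inner_neg_right]⟩
    choose y hy hyv using hk
    refine ⟨∑ k ∈ Finset.range N, y k, finsetSum_mem_finsetSum _ _ _ fun k _ => hy k, ?_⟩
    rw [inner_sum]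
    simp only [hyv, hinner]
    have h1 := hX θ x hx
    have h2 := (abs_le.1 (hψ θ)).1
    simp only [hh] at h2
    linarith
  · refine subset_add_closedBall_of_inner_le hη.le hL hLc fun θ x hx => ⟨X θ, hXL θ, ?_⟩
    obtain ⟨g, hg, rfl⟩ := (mem_finsetSum _ _ _).1 hx
    rw [inner_sum]
    have h1 : ∑ k ∈ Finset.range N, inner ℝ (angleVec θ) (g k)
        ≤ ∑ k ∈ Finset.range N, w k * |Real.sin (θ - ψ k)| :=
      Finset.sum_le_sum fun k hk => (inner_le_abs_inner_of_mem_segment (hg hk)).trans_eq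
        (hinner θ k)
    have h2 := (abs_le.1 (hψ θ)).2
    simp only [hh] at h2
    linarith

/-- The witness is the square [-r, r]². Adding it absorbs an approximation error without leaving the
class of segment sums. -/
lemma exists_segmentSums_closedBall {r : ℝ} (hr : 0 ≤ r) :
    ∃ A ∈ segmentSums (EuclideanSpace ℝ (Fin 2)), closedBall 0 r ⊆ A ∧ A ⊆ closedBall 0 (2 * r) := by
  set e : Fin 2 → EuclideanSpace ℝ (Fin 2) := fun i => EuclideanSpace.single i r with he
  have hs0 : ∀ i : Fin 2, EuclideanSpace.single i (0 : ℝ) = 0 := fun i => by ext j; simp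
  have hmem : ∀ (i : Fin 2) (c : ℝ), |c| ≤ r →
      EuclideanSpace.single i c ∈ segment ℝ (-e i) (e i) := by
    intro i c hc
    rcases hr.eq_or_lt with h0 | h0
    · subst h0
      have : c = 0 := abs_nonpos_iff.1 hc
      simp [he, this, hs0]
    · rw [segment_eq_image']
      obtain ⟨h1, h2⟩ := abs_le.1 hc
      refine ⟨(c + r) / (2 * r), ⟨div_nonneg (by linarith) (by linarith),
        (div_le_one (by linarith)).2 (by linarith)⟩, ?_⟩
      ext j
      by_cases hj : j = i
      · subst hj
        simp [he]
        field_simp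
        ring
      · simp [he, hj]
  have hzero : (0 : EuclideanSpace ℝ (Fin 2)) ∈ ∑ i ∈ Finset.univ, segment ℝ (-e i) (e i) := by
    have h0 := finsetSum_mem_finsetSum Finset.univ (fun i => segment ℝ (-e i) (e i))
      (fun _ => 0) (fun i _ => by simpa only [hs0] using hmem i 0 (by simpa using hr))
    simpa using h0
  obtain ⟨A, hA, hAe⟩ := exists_mem_segmentSums_add_singleton _ _ _ hzero
  rw [singleton_zero, add_zero] at hAe
  refine ⟨A, hA, ?_, ?_⟩
  · intro x hx
    rw [hAe, mem_finsetSum]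
    refine ⟨fun i => EuclideanSpace.single i (x i), fun {i} _ => hmem i _ ?_, ?_⟩
    · exact (PiLp.norm_apply_le x i).trans (mem_closedBall_zero_iff.1 hx)
    · ext j
      fin_cases j <;> simp [Fin.sum_univ_two]
  · intro x hx
    rw [hAe, mem_finsetSum] at hx
    obtain ⟨g, hg, rfl⟩ := hx
    have hgr : ∀ i, ‖g i‖ ≤ r := fun i => by
      have hsub := (convex_closedBall (0 : EuclideanSpace ℝ (Fin 2)) r).segment_subset
        (x := -e i) (y := e i) (by simp [he, abs_of_nonneg hr]) (by simp [he, abs_of_nonneg hr])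
      exact mem_closedBall_zero_iff.1 (hsub (hg (Finset.mem_univ i)))
    rw [mem_closedBall_zero_iff, Fin.sum_univ_two]
    exact (norm_add_le _ _).trans (by linarith [hgr 0, hgr 1])

/-- A planar compact convex set that contains the origin and is symmetric about some point is
approximated from outside by sums of segments that start at the origin. -/
lemma exists_segmentSums_approx {L : Set (EuclideanSpace ℝ (Fin 2))} (hL : IsCompact L)
    (hLc : Convex ℝ L) (h0 : 0 ∈ L) {p : EuclideanSpace ℝ (Fin 2)} (hsymm : IsSymmetricAbout L p)
    {η : ℝ} (hη : 0 < η) :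
    ∃ A ∈ segmentSums (EuclideanSpace ℝ (Fin 2)), L ⊆ A ∧ A ⊆ L + closedBall 0 η := by
  have hsub : L - {p} = L + {-p} := by rw [sub_eq_add_neg, neg_singleton]
  -- Error budget: recentring and approximation cost η/6 each, so the square must contain a ball of
  -- radius 2η/6 and lies in one of radius 4η/6; in total η/6 + η/6 + 4η/6 = η.
  have hη6 : 0 < η / 6 := by positivity
  have hp : -p ∈ L - {p} := ⟨0, h0, p, rfl, by simp⟩
  obtain ⟨N, v, h1, h2⟩ := exists_sum_segment_approx
    (by rw [hsub]; exact hL.add isCompact_singleton)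
    (by rw [hsub]; exact hLc.add (convex_singleton _)) ⟨_, hp⟩
    (show IsSymmetric (L - {p} : Set (EuclideanSpace ℝ (Fin 2))) from hsymm) hη6
  -- The origin of L sits at -p after centring; z is a nearby point of the zonotope, which is
  -- recentred there.
  obtain ⟨z, hz, b, hb, hzb⟩ := h1 hp
  obtain ⟨A, hA, hAz⟩ := exists_mem_segmentSums_add_singleton _ _ _ hz
  obtain ⟨Q, hQ, hQ1, hQ2⟩ := exists_segmentSums_closedBall (r := 2 * (η / 6)) (by positivity)
  rw [← hAz] at h1 h2
  rw [mem_closedBall_zero_iff] at hb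
  simp only at hzb
  have hpz : p = -(z + b) := by rw [hzb, neg_neg]
  refine ⟨A + Q, add_mem hA hQ, fun x hx => ?_, ?_⟩
  · obtain ⟨_, ⟨a, ha, _, rfl, rfl⟩, b', hb', hx'⟩ := h1 (sub_mem_sub hx rfl : x - p ∈ L - {p})
    rw [mem_closedBall_zero_iff] at hb'
    refine ⟨a, ha, b' - b, hQ1 ?_, ?_⟩
    · rw [mem_closedBall_zero_iff]
      exact (norm_sub_le _ _).trans (by linarith)
    · simp only at hx' ⊢
      rw [← eq_sub_iff_add_eq.1 hx', hpz]
      abel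
  · rintro _ ⟨a, ha, q, hq, rfl⟩
    obtain ⟨_, ⟨l, hl, _, rfl, rfl⟩, b', hb', hx'⟩ := h2 (add_mem_add ha (mem_singleton z))
    rw [mem_closedBall_zero_iff] at hb'
    have hq' := mem_closedBall_zero_iff.1 (hQ2 hq)
    refine ⟨l, hl, b' + b + q, ?_, ?_⟩
    · rw [mem_closedBall_zero_iff]
      exact (norm_add₃_le).trans (by linarith)
    · simp only at hx' ⊢
      rw [eq_sub_of_add_eq hx'.symm, hpz]
      abel

/-! ### From segments to symmetric sets, and conclusion -/

lemma IsCompact.measureReal_mono {A B : Set (EuclideanSpace ℝ (Fin 2))} (hB : IsCompact B)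
    (h : A ⊆ B) : normSqMeasure.real A ≤ normSqMeasure.real B :=
  MeasureTheory.measureReal_mono h hB.measure_lt_top.ne

lemma isCompact_convex_nonempty_of_mem_segmentSums {A : Set (EuclideanSpace ℝ (Fin 2))}
    (hA : A ∈ segmentSums (EuclideanSpace ℝ (Fin 2))) :
    IsCompact A ∧ Convex ℝ A ∧ A.Nonempty := by
  induction hA using AddSubmonoid.closure_induction with
  | mem A hA =>
    obtain ⟨u, rfl⟩ := hA
    exact ⟨isCompact_segment_of_endpoints _ _, convex_segment _ _, _, left_mem_segment _ _ _⟩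
  | zero => exact ⟨isCompact_singleton, convex_singleton _, singleton_nonempty _⟩
  | add A B _ _ hA hB =>
    exact ⟨hA.1.add hB.1, hA.2.1.add hB.2.1, hA.2.2.add hB.2.2⟩

/-- For A + B, the inequality for A at K and the one for B at the convex body K + A telescope; this
is why K is quantified inside the induction. -/
lemma normSqMeasure_shell_add_segmentSums {A : Set (EuclideanSpace ℝ (Fin 2))}
    (hA : A ∈ segmentSums (EuclideanSpace ℝ (Fin 2))) {ε : ℝ} (hε : 0 ≤ ε) :
    ∀ {K : Set (EuclideanSpace ℝ (Fin 2))}, IsConvexBody K →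
      normSqMeasure.real (K + A) - normSqMeasure.real K
        ≤ normSqMeasure.real (K + closedBall 0 ε + A) - normSqMeasure.real (K + closedBall 0 ε) := by
  induction hA using AddSubmonoid.closure_induction with
  | mem A hA =>
    obtain ⟨u, rfl⟩ := hA
    exact fun hK => normSqMeasure_shell_add_segment hK u hε
  | zero => exact fun hK => by simp
  | add A B hA' _ hA hB =>
    intro K hK
    obtain ⟨h1, h2, h3⟩ := isCompact_convex_nonempty_of_mem_segmentSums hA'
    have hKA := hB (hK.add h1 h2 h3)
    have hKA' := hA hK
    rw [← add_assoc, ← add_assoc, add_right_comm K (closedBall 0 ε) A]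
    rw [add_right_comm K (closedBall 0 ε) A] at hKA'
    linarith

/-- Adding a symmetric convex set that contains the origin increases the measure of the outer
shells. -/
lemma normSqMeasure_shell_add {K L : Set (EuclideanSpace ℝ (Fin 2))} (hK : IsConvexBody K)
    (hL : IsCompact L) (hLc : Convex ℝ L) (h0 : 0 ∈ L) {p : EuclideanSpace ℝ (Fin 2)}
    (hsymm : IsSymmetricAbout L p) {ε : ℝ} (hε : 0 ≤ ε) :
    normSqMeasure.real (K + closedBall 0 ε) - normSqMeasure.real K
      ≤ normSqMeasure.real (K + L + closedBall 0 ε) - normSqMeasure.real (K + L) := by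
  set C := K + L + closedBall (0 : EuclideanSpace ℝ (Fin 2)) ε with hC
  have hCc : IsCompact C := (hK.isCompact.add hL).add (isCompact_closedBall _ _)
  have hcont := continuousOn_normSqMeasure_add_closedBall hCc
    ((hK.convex.add hLc).add (convex_closedBall _ _)) 0 (mem_Ici.2 le_rfl)
  have hlim : Tendsto (fun η => normSqMeasure.real (C + closedBall 0 η) - normSqMeasure.real (K + L))
      (𝓝[>] 0) (𝓝 (normSqMeasure.real C - normSqMeasure.real (K + L))) := by
    refine Tendsto.sub_const ?_ _
    have := hcont.tendsto.mono_left (nhdsWithin_mono 0 Ioi_subset_Ici_self)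
    simpa using this
  refine ge_of_tendsto hlim ?_
  filter_upwards [self_mem_nhdsWithin] with η hη
  obtain ⟨A, hA, hLA, hAL⟩ := exists_segmentSums_approx hL hLc h0 hsymm (mem_Ioi.1 hη)
  have hAc := (isCompact_convex_nonempty_of_mem_segmentSums hA).1
  have h1 := (hK.isCompact.add hAc).measureReal_mono (add_subset_add_left hLA)
  have h2 := (hCc.add (isCompact_closedBall 0 η)).measureReal_mono
    (A := K + closedBall 0 ε + A) (by
      rw [hC, add_right_comm K L, add_assoc _ L]
      exact add_subset_add_left hAL)
  -- Transposing two terms exchanges the roles of A and the ball. `h1` needs A to contain L, and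
  -- `h2` loses only the η-neighbourhood, which vanishes in the limit.
  have h3 := normSqMeasure_shell_add_segmentSums hA hε hK
  linarith

lemma minkowskiContent_normSqMeasure_le_add {K L : Set (EuclideanSpace ℝ (Fin 2))}
    (hK : IsConvexBody K) (hL : IsCompact L) (hLc : Convex ℝ L) (h0 : 0 ∈ L)
    {p : EuclideanSpace ℝ (Fin 2)} (hsymm : IsSymmetricAbout L p) :
    minkowskiContent normSqMeasure K ≤ minkowskiContent normSqMeasure (K + L) := by
  refine liminf_le_liminf ?_
  filter_upwards [self_mem_nhdsWithin] with ε hε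
  have hε : 0 < ε := hε
  refine ENNReal.div_le_div_right ?_ _
  rw [smul_unitClosedBall, Real.norm_of_nonneg hε.le]
  have hB : IsCompact (closedBall (0 : EuclideanSpace ℝ (Fin 2)) ε) := isCompact_closedBall _ _
  rw [← ofReal_measureReal (hK.isCompact.add hB).measure_lt_top.ne,
    ← ofReal_measureReal hK.isCompact.measure_lt_top.ne,
    ← ofReal_measureReal ((hK.isCompact.add hL).add hB).measure_lt_top.ne,
    ← ofReal_measureReal (hK.isCompact.add hL).measure_lt_top.ne,
    ← ENNReal.ofReal_sub _ measureReal_nonneg, ← ENNReal.ofReal_sub _ measureReal_nonneg]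
  exact ENNReal.ofReal_le_ofReal (normSqMeasure_shell_add hK hL hLc h0 hsymm hε.le)

/-- Continuous densities that agree almost everywhere agree everywhere, yet this one takes the
values 0 and 1. -/
lemma normSqMeasure_ne_smul_volume (c : ℝ≥0∞) : normSqMeasure ≠ c • volume := by
  intro h
  have hd : Continuous fun x : EuclideanSpace ℝ (Fin 2) => ENNReal.ofReal (x 0 ^ 2 + x 1 ^ 2) :=
    ENNReal.continuous_ofReal.comp (by fun_prop)
  rw [normSqMeasure, ← withDensity_const, withDensity_eq_iff_of_sigmaFinite hd.aemeasurable
    aemeasurable_const, hd.ae_eq_iff_eq volume continuous_const] at h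
  have h0 := congrFun h 0
  have h1 := congrFun h (EuclideanSpace.single 0 1)
  simp at h0 h1
  rw [← h0] at h1
  exact one_ne_zero h1

theorem theorem3p9 :
    (∀ K : Set (EuclideanSpace ℝ (Fin 2)), IsConvexBody K →
      ∀ L : Set (EuclideanSpace ℝ (Fin 2)), IsCompact L → Convex ℝ L → 0 ∈ L →
        (∃ p : EuclideanSpace ℝ (Fin 2), IsSymmetricAbout L p) →
          minkowskiContent normSqMeasure (K + L) ≥ minkowskiContent normSqMeasure K) ∧
    normSqMeasure.Regular ∧
    ∀ c : ℝ≥0∞, normSqMeasure ≠ c • MeasureTheory.volume :=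
  ⟨fun _ hK _ hL hLc h0 ⟨_, hp⟩ => minkowskiContent_normSqMeasure_le_add hK hL hLc h0 hp,
    inferInstance, normSqMeasure_ne_smul_volume⟩
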